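/- Fix $\beta>0$ and, for each $n\ge 2$, an integer $m(n)$ with $1\le m(n)\le n-1$. On a common probability space let, for each $n\ge2$, $(Z^{(n,0)}_k)_{1\le k\le n}$ be a random family of points in $\mathbb{C}$, and let $(\gamma^{(n,j)}_k)_{1\le j\le m(n),\,1\le k\le n+1-j}$ be i.i.d. Gamma random variables with shape parameter $\beta/2$ and scale $1$, independent of $(Z^{(n,0)}_k)_{1\le k\le n}$. For $1\le j\le m(n)$ define inductively $(Z^{(n,j)}_k)_{1\le k\le n-j}$ as the family of zeros, counted with multiplicity, of the polynomial $$z\mapsto\sum_{k=1}^{n+1-j}\gamma^{(n,j)}_k\prod_{1\le\ell\le n+1-j,\ \ell\ne k}\bigl(z-Z^{(n,j-1)}_\ell\bigr)$$ (almost surely of degree $n-j$), labelled in any way determined measurably by $Z^{(n,0)}$ and the weights $\gamma^{(n,i)}$, $1\le i\le j$. For $0\le j\le m(n)$ put $\mu_{n,j}=\frac1{n-j}\sum_{k=1}^{n-j}\delta_{Z^{(n,j)}_k}$. Assume that, almost surely, $\mu_{n,0}$ converges weakly, as $n\to\infty$, to a deterministic finite measure $\mu$ on $\mathbb{C}$ (necessarily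 a probability measure), that $$\frac{m(n)}{n/\log n}\longrightarrow 0\qquad(n\to\infty),$$ and that for some $B\ge0$ $$\sup_{n\ge2}\,n^{-B}\sup_{0\le j\le m(n)-1}\mathbb{E}\Bigl[\min_{1\le k\le n-j}\bigl|Z^{(n,j)}_k\bigr|\Bigr]<\infty .$$ Then, almost surely, $\mu_{n,m(n)}$ converges weakly to $\mu$ as $n\to\infty$. -/

import Mathlib

open MeasureTheory ProbabilityTheory Filter Topology Polynomial
open scoped NNReal ENNReal

noncomputable section

/-- The randomized derivative of `∏ k, (X - z k)` with weights `w`: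
the polynomial `∑ k, w k * ∏ (ℓ ≠ k), (X - z ℓ)`. -/
def randomizedDerivative {N : ℕ} (w : Fin N → ℝ) (z : Fin N → ℂ) : ℂ[X] :=
  ∑ k, C (w k : ℂ) * ∏ l ∈ Finset.univ.erase k, (X - C (z l))

/-- The empirical measure `(1 / N) * ∑ k, δ_(z k)` of the points `z 0, …, z (N - 1)`, as an element
of the space of finite measures on `ℂ`, whose topology is that of weak convergence. -/
def empiricalMeasure {N : ℕ} (z : Fin N → ℂ) : FiniteMeasure ℂ :=
  (N : ℝ≥0)⁻¹ • ∑ k, (diracProba (z k)).toFiniteMeasure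

/-- The σ-algebra generated by the initial points `Z 0` and by the weights used in the
first `j` steps. -/
@[reducible]
def pastSigmaAlgebra {Ω : Type*} {n : ℕ} (Z : (j : ℕ) → Fin (n - j) → Ω → ℂ)
    (γ : (j : ℕ) → Fin (n - j) → Ω → ℝ) (j : ℕ) : MeasurableSpace Ω :=
  (⨆ k, MeasurableSpace.comap (Z 0 k) inferInstance) ⊔
    ⨆ i, ⨆ (_ : i < j), ⨆ k, MeasurableSpace.comap (γ i k) inferInstance

/-- `Z 0, Z 1, …, Z m` are the families of points obtained from the `n` random points `Z 0` by
iterating the randomized derivative `m` times with independent Gamma weights of shape parameter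
`β / 2` (and unit scale).

Indexing: `Z j` consists of `n - j` points, and `γ j` consists of the `n - j` weights which are
used in the step from `Z j` to `Z (j + 1)`. Only `Z j` with `j ≤ m` and `γ j` with `j < m`
matter.

The points of `Z (j + 1)` are the zeros, with multiplicity, of the randomized derivative of `Z j`.
This is asked almost surely, since on a null event the weights may vanish; the zeros may be labelled
in any way which is determined measurably by the initial points and the weights used so far. -/
structure IsIteratedRandomizedDerivative {Ω : Type*} [MeasurableSpace Ω] (P : Measure Ω)
    (β : ℝ) (n m : ℕ) (Z : (j : ℕ) → Fin (n - j) → Ω → ℂ)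
    (γ : (j : ℕ) → Fin (n - j) → Ω → ℝ) : Prop where
  measurable_init : ∀ k, Measurable (Z 0 k)
  measurable_weight : ∀ j < m, ∀ k, Measurable (γ j k)
  hasLaw_weight : ∀ j < m, ∀ k, HasLaw (γ j k) (gammaMeasure (β / 2) 1) P
  iIndepFun_weight : iIndepFun (fun p : (Σ j : Fin m, Fin (n - j)) => γ p.1 p.2) P
  indepFun_init_weight : IndepFun (fun ω k => Z 0 k ω)
    (fun ω (p : (Σ j : Fin m, Fin (n - j))) => γ p.1 p.2 ω) P
  measurable_step : ∀ j < m, ∀ k, Measurable[pastSigmaAlgebra Z γ (j + 1)] (Z (j + 1) k)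
  roots_step : ∀ j < m, ∀ᵐ ω ∂P,
    Finset.univ.val.map (fun k => Z (j + 1) k ω) =
      (randomizedDerivative (fun k => γ j k ω) (fun k => Z j k ω)).roots

end

/-! If `Q` is the randomized derivative of `P = ∏ (X - z k)`, then `Q / P` is the weighted Cauchy
sum `S(x) = ∑ w k / (x - z k)`. Hence `log ‖S‖` is, up to a constant, the difference of the
logarithmic potentials of the new and the old points. Testing points against `f` is replaced by
testing against `f` smoothed by a kernel that is itself a difference of two circle averages of `log
‖·‖`. No Laplacian is needed, the unknown constant cancels, and one step changes the smoothed sum by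
at most a multiple of the local `L¹` norm of `log ‖S‖` (`enorm_sum_logSmooth_roots_sub_le`). These
changes are added up over the steps.

It remains to show that the total of these norms is `o(n)`. By `abs_log_le`, each norm is `O(log n)`
plus `n ^ (-(B + 4))` times local integrals of `‖S‖` and `‖S‖⁻¹ ^ δ`. The `O(log n)` parts add up to
`O(m(n) log n) = o(n)`. The integral of `‖S‖` has mean `O(n)`, since `1 / ‖x‖` is locally integrable
in the plane. The negative moment is an anticoncentration estimate: with the points and all weights
but one fixed, `S` is affine in the remaining Gamma weight. That weight is taken at the point
nearest to the origin, which is why the mean of the minimal modulus enters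
(`exists_lintegral_pi_cauchyMoment_le`). The means of the remainders are then summable in `n`, so
the remainders are almost surely bounded.

This gives vague closeness of the final and the initial empirical measures. Both have mass one and
the initial ones converge weakly to `μ`, so no mass escapes. -/

/-! ### Local integrability of the Cauchy kernel -/

theorem lintegral_ball_inv_enorm_lt_top : ∫⁻ z in Metric.ball (0 : ℂ) 1, ‖z‖ₑ⁻¹ < ⊤ := by
  have h : IntegrableOn (fun z : ℂ => ‖z‖⁻¹) (Metric.ball 0 1) := by
    have := integrableOn_fun_norm_addHaar (E := ℂ) (μ := volume) (f := fun r : ℝ => r⁻¹) (r := 1)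
    rw [this]
    refine (integrableOn_const (C := (1 : ℝ)) (s := Set.Ioo (0 : ℝ) 1)
      (by simp)).congr_fun ?_ measurableSet_Ioo
    intro x hx
    have : x ≠ 0 := hx.1.ne'
    simp [this]
  refine lt_of_eq_of_lt (setLIntegral_congr_fun_ae measurableSet_ball ?_) h.2
  filter_upwards [compl_mem_ae_iff.2 (measure_singleton (0 : ℂ))] with z hz _
  have hz : z ≠ 0 := hz
  rw [enorm_inv (norm_ne_zero_iff.2 hz), enorm_norm]

theorem exists_forall_lintegral_inv_enorm_sub_le (ρ : ℝ) : ∃ C : ℝ≥0∞, C < ⊤ ∧ ∀ w : ℂ,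
    ∫⁻ z in Metric.closedBall (0 : ℂ) ρ, ‖z - w‖ₑ⁻¹ ≤ C := by
  refine ⟨volume (Metric.closedBall (0 : ℂ) ρ) + ∫⁻ z in Metric.ball (0 : ℂ) 1, ‖z‖ₑ⁻¹,
    ENNReal.add_lt_top.2 ⟨measure_closedBall_lt_top, lintegral_ball_inv_enorm_lt_top⟩,
    fun w => ?_⟩
  have hpt : ∀ z : ℂ, ‖z - w‖ₑ⁻¹ ≤
      1 + (Metric.ball (0 : ℂ) 1).indicator (fun z => ‖z‖ₑ⁻¹) (z - w) := by
    intro z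
    by_cases hz : z - w ∈ Metric.ball (0 : ℂ) 1
    · simp [Set.indicator_of_mem hz]
    · rw [Set.indicator_of_notMem hz, add_zero, ENNReal.inv_le_one]
      have h1 : 1 ≤ ‖z - w‖ := by simpa using hz
      rw [← ofReal_norm]
      simpa using ENNReal.ofReal_le_ofReal h1
  have hm : Measurable ((Metric.ball (0 : ℂ) 1).indicator (fun z => ‖z‖ₑ⁻¹)) :=
    (by fun_prop : Measurable fun z : ℂ => ‖z‖ₑ⁻¹).indicator measurableSet_ball
  calc ∫⁻ z in Metric.closedBall (0 : ℂ) ρ, ‖z - w‖ₑ⁻¹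
      ≤ ∫⁻ z in Metric.closedBall (0 : ℂ) ρ,
        (1 + (Metric.ball (0 : ℂ) 1).indicator (fun z => ‖z‖ₑ⁻¹) (z - w)) :=
        lintegral_mono hpt
    _ = volume (Metric.closedBall (0 : ℂ) ρ) + ∫⁻ z in Metric.closedBall (0 : ℂ) ρ,
        (Metric.ball (0 : ℂ) 1).indicator (fun z => ‖z‖ₑ⁻¹) (z - w) := by
        rw [lintegral_add_left measurable_const]; simp
    _ ≤ _ := by
        refine add_le_add le_rfl ((setLIntegral_le_lintegral _ _).trans ?_)
        rw [lintegral_sub_right_eq_self, lintegral_indicator measurableSet_ball]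

/-! ### The smoothing kernel -/

/-- The difference of the averages of `z ↦ log ‖z - w‖` over the circles of radii `R` and `R / 2`
centred at `w + v`, as a function of `v`. -/
noncomputable def logBump (R : ℝ) (v : ℂ) : ℝ :=
  (Real.log R + Real.posLog (R⁻¹ * ‖v‖)) -
    (Real.log (R / 2) + Real.posLog ((R / 2)⁻¹ * ‖v‖))

theorem continuous_logBump (R : ℝ) : Continuous (logBump R) := by
  unfold logBump
  have := Real.continuous_posLog
  fun_prop

theorem log_add_posLog_inv_mul {r x : ℝ} (hr : 0 < r) (hx : 0 ≤ x) :
    Real.log r + Real.posLog (r⁻¹ * x) = Real.log (max r x) := by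
  rcases le_total x r with h | h
  · rw [max_eq_left h, Real.posLog_eq_zero_iff _ |>.2, add_zero]
    rw [abs_of_nonneg (by positivity)]
    exact inv_mul_le_one_of_le₀ h hr.le
  · have hx' : 0 < x := hr.trans_le h
    rw [max_eq_right h, Real.posLog_eq_log, Real.log_mul (by positivity) (by positivity),
      Real.log_inv]
    · ring
    · rw [abs_of_nonneg (by positivity), inv_mul_eq_div, one_le_div hr]; exact h

theorem logBump_eq {R : ℝ} (hR : 0 < R) (v : ℂ) :
    logBump R v = Real.log (max R ‖v‖) - Real.log (max (R / 2) ‖v‖) := by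
  rw [logBump, log_add_posLog_inv_mul hR (norm_nonneg v),
    log_add_posLog_inv_mul (half_pos hR) (norm_nonneg v)]

theorem logBump_nonneg {R : ℝ} (hR : 0 < R) (v : ℂ) : 0 ≤ logBump R v := by
  rw [logBump_eq hR, sub_nonneg]
  refine Real.log_le_log (lt_max_of_lt_left (half_pos hR)) (max_le_max_right _ (by linarith))

theorem logBump_of_le {R : ℝ} (hR : 0 < R) {v : ℂ} (hv : R ≤ ‖v‖) : logBump R v = 0 := by
  rw [logBump_eq hR, max_eq_right hv, max_eq_right (by linarith), sub_self]

theorem logBump_zero_pos {R : ℝ} (hR : 0 < R) : 0 < logBump R 0 := by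
  rw [logBump_eq hR, norm_zero, max_eq_left hR.le, max_eq_left (half_pos hR).le, sub_pos]
  exact Real.log_lt_log (half_pos hR) (by linarith)

theorem hasCompactSupport_logBump {R : ℝ} (hR : 0 < R) : HasCompactSupport (logBump R) := by
  refine HasCompactSupport.of_support_subset_isCompact (isCompact_closedBall (0 : ℂ) R) ?_
  intro v hv
  by_contra h
  exact hv (logBump_of_le hR (by simpa using (not_le.1 (by simpa using h)).le))

theorem integrable_logBump {R : ℝ} (hR : 0 < R) : Integrable (logBump R) :=
  (continuous_logBump R).integrable_of_hasCompactSupport (hasCompactSupport_logBump hR)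

theorem integral_logBump_pos {R : ℝ} (hR : 0 < R) : 0 < ∫ v, logBump R v :=
  (continuous_logBump R).integral_pos_of_hasCompactSupport_nonneg_nonzero
    (hasCompactSupport_logBump hR) (logBump_nonneg hR) (logBump_zero_pos hR).ne'

/-- The smoothing of `f` by `logBump R`. -/
noncomputable def logSmooth (R : ℝ) (f : ℂ → ℝ) (w : ℂ) : ℝ := ∫ c, f c * logBump R (c - w)

theorem integrable_mul_logBump {R : ℝ} (hR : 0 < R) {f : ℂ → ℝ} (hf : Continuous f) (w : ℂ) :
    Integrable fun c => f c * logBump R (c - w) := by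
  refine Continuous.integrable_of_hasCompactSupport
    (hf.mul ((continuous_logBump R).comp (continuous_sub_right w))) ?_
  exact HasCompactSupport.mul_left
    ((hasCompactSupport_logBump hR).comp_homeomorph (Homeomorph.subRight w))

/-- The kernel is nonnegative and vanishes at distance at least `R`, so only the oscillation of `f`
within distance `R` of `w` matters. The total mass of the kernel is not normalized. -/
theorem abs_logSmooth_sub_le {R : ℝ} (hR : 0 < R) {f : ℂ → ℝ} (hf : Continuous f) {ε : ℝ}
    (w : ℂ) (h : ∀ c, ‖c - w‖ < R → |f c - f w| ≤ ε) :
    |logSmooth R f w - (∫ v, logBump R v) * f w| ≤ (∫ v, logBump R v) * ε := by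
  have h1 : ∫ c, logBump R (c - w) = ∫ v, logBump R v := integral_sub_right_eq_self _ w
  have hi : Integrable fun c => logBump R (c - w) := (integrable_logBump hR).comp_sub_right w
  rw [logSmooth, ← h1, ← integral_mul_const, ← integral_sub (integrable_mul_logBump hR hf w)
    (hi.mul_const _), ← integral_mul_const, ← Real.norm_eq_abs]
  refine norm_integral_le_of_norm_le (hi.mul_const _) (ae_of_all _ fun c => ?_)
  have h0 := logBump_nonneg hR (c - w)
  rw [show f c * logBump R (c - w) - logBump R (c - w) * f w = logBump R (c - w) * (f c - f w) by
    ring, norm_mul, Real.norm_of_nonneg h0, Real.norm_eq_abs]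
  by_cases hc : ‖c - w‖ < R
  · exact mul_le_mul_of_nonneg_left (h c hc) h0
  · simp [logBump_of_le hR (not_lt.1 hc)]

/-! ### Smoothed sums and the `L¹` norm of the potential -/

/-- The logarithmic potential `C + ∑ i, log ‖z - a i‖ - ∑ i, log ‖z - b i‖`. -/
noncomputable def logRatio {ι κ : Type*} [Fintype ι] [Fintype κ] (C : ℝ) (a : ι → ℂ) (b : κ → ℂ)
    (z : ℂ) : ℝ :=
  C + ∑ i, Real.log ‖z - a i‖ - ∑ i, Real.log ‖z - b i‖

section logRatio
variable {ι κ : Type*} [Fintype ι] [Fintype κ] (C : ℝ) (a : ι → ℂ) (b : κ → ℂ)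

@[fun_prop]
theorem measurable_logRatio : Measurable (logRatio C a b) := by
  unfold logRatio; fun_prop

theorem circleAverage_logRatio {R : ℝ} (hR : R ≠ 0) (c : ℂ) :
    Real.circleAverage (logRatio C a b) c R =
      C + ∑ i, (Real.log R + Real.posLog (R⁻¹ * ‖c - a i‖)) -
        ∑ i, (Real.log R + Real.posLog (R⁻¹ * ‖c - b i‖)) := by
  have hA : ∀ w : ℂ, CircleIntegrable (fun z => Real.log ‖z - w‖) c R := fun w =>
    circleIntegrable_log_norm_sub_const R
  have hS : CircleIntegrable (fun z => ∑ i, Real.log ‖z - a i‖) c R :=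
    CircleIntegrable.fun_sum _ fun i _ => hA (a i)
  have hS' : CircleIntegrable (fun z => ∑ i, Real.log ‖z - b i‖) c R :=
    CircleIntegrable.fun_sum _ fun i _ => hA (b i)
  have hC : CircleIntegrable (fun _ : ℂ => C) c R := circleIntegrable_const _ _ _
  unfold logRatio
  have hCS : CircleIntegrable (fun z => C + ∑ i, Real.log ‖z - a i‖) c R := hC.add hS
  rw [Real.circleAverage_fun_sub hCS hS', Real.circleAverage_fun_add hC hS,
    Real.circleAverage_const, Real.circleAverage_fun_sum fun i _ => hA (a i),
    Real.circleAverage_fun_sum fun i _ => hA (b i)]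
  simp_rw [circleAverage_log_norm_sub_const_eq_log_radius_add_posLog hR]

theorem enorm_circleAverage_le (u : ℂ → ℝ) (c : ℂ) (R : ℝ) :
    ‖Real.circleAverage u c R‖ₑ ≤
      ENNReal.ofReal (2 * Real.pi)⁻¹ * ∫⁻ θ in Set.Ioc 0 (2 * Real.pi), ‖u (circleMap c R θ)‖ₑ := by
  rw [Real.circleAverage_def, enorm_smul, intervalIntegral.integral_of_le Real.two_pi_pos.le,
    Real.enorm_of_nonneg (by positivity)]
  gcongr
  exact enorm_integral_le_lintegral_enorm _

/-- By Tonelli, the left side is at most an average over angles of integrals of `‖u‖ₑ` over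
translated balls. A shift by at most `R ≤ 1` stays inside the ball of radius `ρ + 1`. -/
theorem lintegral_enorm_circleAverage_le (u : ℂ → ℝ) (hu : Measurable u) {R : ℝ} (hR : 0 ≤ R)
    (hR1 : R ≤ 1) (ρ : ℝ) :
    ∫⁻ c in Metric.closedBall 0 ρ, ‖Real.circleAverage u c R‖ₑ ≤
      ∫⁻ z in Metric.closedBall 0 (ρ + 1), ‖u z‖ₑ := by
  set q := ENNReal.ofReal (2 * Real.pi)⁻¹ with hq
  have hmeas : Measurable fun p : ℂ × ℝ => ‖u (circleMap p.1 R p.2)‖ₑ := by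
    unfold circleMap; fun_prop
  calc ∫⁻ c in Metric.closedBall 0 ρ, ‖Real.circleAverage u c R‖ₑ
      ≤ ∫⁻ c in Metric.closedBall 0 ρ,
        q * ∫⁻ θ in Set.Ioc 0 (2 * Real.pi), ‖u (circleMap c R θ)‖ₑ :=
        lintegral_mono fun c => enorm_circleAverage_le u c R
    _ = q * ∫⁻ θ in Set.Ioc 0 (2 * Real.pi), ∫⁻ c in Metric.closedBall 0 ρ,
          ‖u (circleMap c R θ)‖ₑ := by
        rw [lintegral_const_mul' _ _ ENNReal.ofReal_ne_top, lintegral_lintegral_swap]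
        exact hmeas.aemeasurable
    _ ≤ q * ∫⁻ θ in Set.Ioc 0 (2 * Real.pi), ∫⁻ z in Metric.closedBall 0 (ρ + 1), ‖u z‖ₑ := by
        refine mul_le_mul' le_rfl (lintegral_mono fun θ => ?_)
        rw [← lintegral_indicator Metric.isClosed_closedBall.measurableSet,
          ← lintegral_indicator Metric.isClosed_closedBall.measurableSet,
          ← lintegral_add_right_eq_self
            ((Metric.closedBall (0 : ℂ) (ρ + 1)).indicator fun z => ‖u z‖ₑ) (circleMap 0 R θ)]
        refine lintegral_mono fun c => ?_
        by_cases hc : c ∈ Metric.closedBall (0 : ℂ) ρ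
        · rw [Set.indicator_of_mem hc, Set.indicator_of_mem]
          · simp [circleMap]
          · rw [mem_closedBall_zero_iff] at hc ⊢
            refine (norm_add_le _ _).trans (add_le_add hc ?_)
            simpa [abs_of_nonneg hR] using hR1
        · simp [Set.indicator_of_notMem hc]
    _ = ∫⁻ z in Metric.closedBall 0 (ρ + 1), ‖u z‖ₑ := by
        rw [setLIntegral_const, Real.volume_Ioc, sub_zero, mul_comm, mul_assoc, hq,
          ← ENNReal.ofReal_mul (by positivity),
          mul_inv_cancel₀ Real.two_pi_pos.ne', ENNReal.ofReal_one, mul_one]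

/-- The difference of the smoothed sums is the integral of `f` against the difference of two circle
averages of the potential. Each average is bounded in `L¹` on the support of `f`, whence the factor
`2`. -/
theorem enorm_sum_logSmooth_sub_le {R : ℝ} (hR : 0 < R) (hR1 : R ≤ 1) {f : ℂ → ℝ}
    (hf : Continuous f) {M : ℝ≥0} (hM : ∀ c, ‖f c‖ₑ ≤ M) {ρ : ℝ}
    (hρ : ∀ c, f c ≠ 0 → c ∈ Metric.closedBall (0 : ℂ) ρ) :
    ‖∑ i, logSmooth R f (a i) - ∑ i, logSmooth R f (b i)‖ₑ ≤
      2 * M * ∫⁻ z in Metric.closedBall 0 (ρ + 1), ‖logRatio C a b z‖ₑ := by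
  set u := logRatio C a b
  have hu : Measurable u := measurable_logRatio C a b
  -- The constant `C` is its own average over both circles and cancels.
  have key : ∑ i, logSmooth R f (a i) - ∑ i, logSmooth R f (b i) =
      ∫ c, f c * (Real.circleAverage u c R - Real.circleAverage u c (R / 2)) := by
    unfold logSmooth
    rw [← integral_finsetSum _ fun i _ => integrable_mul_logBump hR hf (a i),
      ← integral_finsetSum _ fun i _ => integrable_mul_logBump hR hf (b i), ← integral_sub
        (integrable_finsetSum _ fun i _ => integrable_mul_logBump hR hf (a i))
        (integrable_finsetSum _ fun i _ => integrable_mul_logBump hR hf (b i))]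
    congr with c
    rw [circleAverage_logRatio _ _ _ hR.ne', circleAverage_logRatio _ _ _ (half_pos hR).ne',
      ← Finset.mul_sum, ← Finset.mul_sum]
    simp only [logBump, Finset.sum_sub_distrib]
    ring
  rw [key]
  have hmc : ∀ r : ℝ, Measurable fun c => Real.circleAverage u c r := by
    intro r
    simp_rw [Real.circleAverage_def, intervalIntegral.integral_of_le Real.two_pi_pos.le]
    have h : Measurable fun p : ℂ × ℝ => u (circleMap p.1 r p.2) := by unfold circleMap; fun_prop
    have h' : StronglyMeasurable fun c : ℂ =>
        ∫ θ in Set.Ioc 0 (2 * Real.pi), u (circleMap c r θ) :=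
      h.stronglyMeasurable.integral_prod_right'
    exact h'.measurable.const_smul (2 * Real.pi)⁻¹
  have hball := (Metric.isClosed_closedBall (x := (0 : ℂ)) (ε := ρ)).measurableSet
  calc _ ≤ ∫⁻ c, ‖f c * (Real.circleAverage u c R - Real.circleAverage u c (R / 2))‖ₑ :=
        enorm_integral_le_lintegral_enorm _
    _ ≤ ∫⁻ c, (Metric.closedBall (0 : ℂ) ρ).indicator (fun c =>
        M * (‖Real.circleAverage u c R‖ₑ + ‖Real.circleAverage u c (R / 2)‖ₑ)) c := by
        refine lintegral_mono fun c => ?_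
        by_cases hc : f c = 0
        · simp [hc]
        · rw [Set.indicator_of_mem (hρ c hc), enorm_mul]
          exact mul_le_mul' (hM c) enorm_sub_le
    _ = M * ((∫⁻ c in Metric.closedBall (0 : ℂ) ρ, ‖Real.circleAverage u c R‖ₑ) +
        ∫⁻ c in Metric.closedBall (0 : ℂ) ρ, ‖Real.circleAverage u c (R / 2)‖ₑ) := by
        rw [lintegral_indicator hball, lintegral_const_mul' _ _ ENNReal.coe_ne_top,
          lintegral_add_left (hmc R).enorm]
    _ ≤ M * ((∫⁻ z in Metric.closedBall 0 (ρ + 1), ‖u z‖ₑ) +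
        ∫⁻ z in Metric.closedBall 0 (ρ + 1), ‖u z‖ₑ) := by
        exact mul_le_mul' le_rfl (add_le_add (lintegral_enorm_circleAverage_le u hu hR.le hR1 ρ)
          (lintegral_enorm_circleAverage_le u hu (half_pos hR).le (by linarith) ρ))
    _ = _ := by ring

end logRatio

/-! ### One step as a difference of potentials -/

/-- The logarithmic derivative of `∏ (x - z k)` with weights `w`. -/
noncomputable def weightedCauchySum {ι : Type*} [Fintype ι] (w : ι → ℝ) (z : ι → ℂ) (x : ℂ) : ℂ :=
  ∑ k, (w k : ℂ) * (x - z k)⁻¹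

theorem eval_randomizedDerivative {N : ℕ} (w : Fin N → ℝ) (z : Fin N → ℂ) {x : ℂ}
    (hx : ∀ k, x ≠ z k) :
    (randomizedDerivative w z).eval x = (∏ k, (x - z k)) * weightedCauchySum w z x := by
  simp only [randomizedDerivative, weightedCauchySum, eval_finsetSum, eval_mul, eval_C,
    eval_prod, eval_sub, eval_X, Finset.mul_sum]
  refine Finset.sum_congr rfl fun k _ => ?_
  have := sub_ne_zero.2 (hx k)
  rw [← Finset.mul_prod_erase Finset.univ (fun k => x - z k) (Finset.mem_univ k)]
  field_simp

theorem exists_log_norm_weightedCauchySum_eq {N N' : ℕ} (hN' : 0 < N') (w : Fin N → ℝ)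
    (z : Fin N → ℂ) (z' : Fin N' → ℂ)
    (h : Finset.univ.val.map z' = (randomizedDerivative w z).roots) :
    ∃ C : ℝ, ∀ x, (∀ k, x ≠ z k) → (∀ k, x ≠ z' k) →
      Real.log ‖weightedCauchySum w z x‖ = logRatio C z' z x := by
  set Q := randomizedDerivative w z
  -- The zero polynomial has no `roots` by convention, which contradicts `0 < N'`.
  have hQ : Q ≠ 0 := by
    intro h0
    rw [h0, roots_zero] at h
    have := congrArg Multiset.card h
    simp at this
    omega
  refine ⟨Real.log ‖Q.leadingCoeff‖, fun x hx hx' => ?_⟩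
  have h1 : Q.eval x = Q.leadingCoeff * ∏ k, (x - z' k) := by
    have hprod : ((Finset.univ.val.map z').map (X - C ·)).prod = ∏ k, (X - C (z' k)) := by
      rw [Multiset.map_map]; rfl
    conv_lhs => rw [(IsAlgClosed.splits Q).eq_prod_roots, ← h, hprod]
    simp [eval_prod]
  have h2 : ‖∏ k, (x - z k)‖ * ‖weightedCauchySum w z x‖ =
      ‖Q.leadingCoeff‖ * ‖∏ k, (x - z' k)‖ := by
    rw [← norm_mul, ← norm_mul, ← h1, eval_randomizedDerivative w z hx]
  have hP : ‖∏ k, (x - z k)‖ ≠ 0 :=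
    norm_ne_zero_iff.2 (Finset.prod_ne_zero_iff.2 fun k _ => sub_ne_zero.2 (hx k))
  have hP' : ‖∏ k, (x - z' k)‖ ≠ 0 :=
    norm_ne_zero_iff.2 (Finset.prod_ne_zero_iff.2 fun k _ => sub_ne_zero.2 (hx' k))
  have hl : ‖Q.leadingCoeff‖ ≠ 0 := norm_ne_zero_iff.2 (leadingCoeff_ne_zero.2 hQ)
  have hS : ‖weightedCauchySum w z x‖ ≠ 0 := by
    intro h0
    rw [h0, mul_zero] at h2
    exact mul_ne_zero hl hP' h2.symm
  have h3 := congrArg Real.log h2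
  rw [Real.log_mul hP hS, Real.log_mul hl hP', norm_prod, norm_prod,
    Real.log_prod fun k _ => norm_ne_zero_iff.2 (sub_ne_zero.2 (hx k)),
    Real.log_prod fun k _ => norm_ne_zero_iff.2 (sub_ne_zero.2 (hx' k))] at h3
  simp only [logRatio]
  linarith

theorem ae_forall_ne {ι : Type*} [Finite ι] (z : ι → ℂ) : ∀ᵐ x : ℂ, ∀ k, x ≠ z k :=
  ae_all_iff.2 fun k => compl_mem_ae_iff.2 (measure_singleton (z k))

/-- One step changes the sum of a smoothed test function by at most a multiple of the local `L¹`
norm of `log ‖weightedCauchySum w z ·‖`. -/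
theorem enorm_sum_logSmooth_roots_sub_le {N N' : ℕ} (hN' : 0 < N') (w : Fin N → ℝ)
    (z : Fin N → ℂ) (z' : Fin N' → ℂ)
    (h : Finset.univ.val.map z' = (randomizedDerivative w z).roots)
    {R : ℝ} (hR : 0 < R) (hR1 : R ≤ 1) {f : ℂ → ℝ}
    (hf : Continuous f) {M : ℝ≥0} (hM : ∀ c, ‖f c‖ₑ ≤ M) {ρ : ℝ}
    (hρ : ∀ c, f c ≠ 0 → c ∈ Metric.closedBall (0 : ℂ) ρ) :
    ‖∑ i, logSmooth R f (z' i) - ∑ i, logSmooth R f (z i)‖ₑ ≤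
      2 * M * ∫⁻ x in Metric.closedBall 0 (ρ + 1), ‖Real.log ‖weightedCauchySum w z x‖‖ₑ := by
  obtain ⟨C, hC⟩ := exists_log_norm_weightedCauchySum_eq hN' w z z' h
  refine (enorm_sum_logSmooth_sub_le C z' z hR hR1 hf hM hρ).trans_eq ?_
  congr 1
  refine lintegral_congr_ae (ae_restrict_of_ae ?_)
  filter_upwards [ae_forall_ne z, ae_forall_ne z'] with x hx hx'
  rw [hC x hx hx']

/-! ### Logarithm and Gamma estimates -/

/-- Apply `log y ≤ y` to `exp (-L) * t` with `t = s` and `t = s⁻¹ ^ δ`. Taking `L` of order `log n`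
makes moments of polynomial size negligible at the price of a logarithmic term. -/
theorem abs_log_le {L s δ : ℝ} (hL : 0 ≤ L) (hδ : 0 < δ) (hs : 0 < s) :
    |Real.log s| ≤ L * (1 + δ⁻¹) + Real.exp (-L) * (s + δ⁻¹ * s⁻¹ ^ δ) := by
  have key : ∀ t : ℝ, 0 < t → Real.log t ≤ L + Real.exp (-L) * t := by
    intro t ht
    have := Real.log_le_self (x := Real.exp (-L) * t) (by positivity)
    rw [Real.log_mul (by positivity) ht.ne', Real.log_exp] at this
    linarith
  have h1 := key s hs
  have h2 := key (s⁻¹ ^ δ) (by positivity)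
  rw [Real.log_rpow (by positivity), Real.log_inv] at h2
  have h3 : -Real.log s ≤ δ⁻¹ * L + Real.exp (-L) * (δ⁻¹ * s⁻¹ ^ δ) := by
    have := mul_le_mul_of_nonneg_left h2 (inv_pos.2 hδ).le
    rw [← mul_assoc, inv_mul_cancel₀ hδ.ne', one_mul] at this
    linarith
  have h4 : 0 ≤ δ⁻¹ * L := by positivity
  have h5 : 0 ≤ Real.exp (-L) * (δ⁻¹ * s⁻¹ ^ δ) := by positivity
  have h6 : 0 ≤ Real.exp (-L) * s := by positivity
  rw [abs_le']
  constructor <;> linarith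

theorem lintegral_enorm_gammaMeasure_lt_top {a : ℝ} (ha : 0 < a) :
    ∫⁻ x, ‖x‖ₑ ∂(gammaMeasure a 1) < ⊤ := by
  have hm : ∀ b, Measurable (gammaPDF b 1) := fun b =>
    (measurable_gammaPDFReal b 1).ennreal_ofReal
  rw [gammaMeasure, lintegral_withDensity_eq_lintegral_mul _ (hm a) (by fun_prop)]
  calc _ = ∫⁻ x, ENNReal.ofReal a * gammaPDF (a + 1) 1 x := by
        refine lintegral_congr fun x => ?_
        rw [Pi.mul_apply, gammaPDF, gammaPDF, Real.enorm_eq_ofReal_abs,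
          ← ENNReal.ofReal_mul (gammaPDFReal_nonneg ha one_pos x), ← ENNReal.ofReal_mul ha.le]
        congr 1
        simp only [gammaPDFReal]
        split_ifs with hx
        · have hG := (Real.Gamma_pos_of_pos ha).ne'
          rw [abs_of_nonneg hx, Real.Gamma_add_one ha.ne', Real.one_rpow, Real.one_rpow,
            add_sub_cancel_right]
          rcases hx.eq_or_lt with rfl | hx
          · simp [Real.zero_rpow ha.ne']
          · rw [Real.rpow_sub_one hx.ne']
            field_simp
        · simp
    _ < ⊤ := by
        rw [lintegral_const_mul _ (hm _), lintegral_gammaPDF_eq_one (by linarith) one_pos]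
        simp

theorem exists_gammaPDFReal_le {a : ℝ} (ha : 0 < a) :
    ∃ K : ℝ, 0 ≤ K ∧ ∀ x, 0 < x → gammaPDFReal a 1 x ≤ K * x ^ (min a 1 - 1) := by
  have hG := Real.Gamma_pos_of_pos ha
  rcases le_or_gt a 1 with h | h
  · refine ⟨(Real.Gamma a)⁻¹, by positivity, fun x hx => ?_⟩
    rw [gammaPDFReal, if_pos hx.le, min_eq_left h, Real.one_rpow, one_div]
    refine mul_le_of_le_one_right (by positivity) ?_
    rw [Real.exp_le_one_iff]; linarith
  · refine ⟨(Real.Gamma a)⁻¹ * (a - 1) ^ (a - 1), ?_, fun x hx => ?_⟩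
    · have : 0 < a - 1 := by linarith
      positivity
    · have ha1 : 0 < a - 1 := by linarith
      rw [gammaPDFReal, if_pos hx.le, min_eq_right h.le, Real.one_rpow, one_div, sub_self,
        Real.rpow_zero, mul_one, mul_assoc]
      refine mul_le_mul_of_nonneg_left ?_ (by positivity)
      have h1 : x ≤ (a - 1) * Real.exp (x / (a - 1)) := by
        have := Real.add_one_le_exp (x / (a - 1))
        calc x = (a - 1) * (x / (a - 1)) := by field_simp
          _ ≤ _ := mul_le_mul_of_nonneg_left (by linarith) ha1.le
      have h2 := Real.rpow_le_rpow hx.le h1 ha1.le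
      rw [Real.mul_rpow ha1.le (Real.exp_pos _).le, ← Real.exp_mul,
        div_mul_cancel₀ _ ha1.ne'] at h2
      calc _ ≤ (a - 1) ^ (a - 1) * Real.exp x * Real.exp (-(1 * x)) :=
            mul_le_mul_of_nonneg_right h2 (Real.exp_pos _).le
        _ = _ := by rw [mul_assoc, ← Real.exp_add]; simp

theorem lintegral_ball_norm_rpow_lt_top {s : ℝ} (hs : -1 < s) :
    ∫⁻ x in Metric.ball (0 : ℝ) 1, ENNReal.ofReal (‖x‖ ^ s) < ⊤ := by
  have h : IntegrableOn (fun x : ℝ => ‖x‖ ^ s) (Metric.ball 0 1) := by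
    have := integrableOn_fun_norm_addHaar (E := ℝ) (μ := volume) (f := fun r : ℝ => r ^ s) (r := 1)
    rw [this]
    simpa using (intervalIntegral.integrableOn_Ioo_rpow_iff (s := s) one_pos).2 hs
  exact h.lintegral_lt_top

/-- The density is at most `K * x ^ (2 * δ - 1)` with `δ = min a 1 / 2`, so singularities at `0` and
`c` may collide. Evaluating the product of powers at the smaller of `x` and `‖x - c‖` gives the
exponent `δ - 1 > -1`, which is integrable uniformly in `c`. -/
theorem exists_lintegral_gammaMeasure_inv_rpow_le {a : ℝ} (ha : 0 < a) :
    ∃ C : ℝ≥0∞, C < ⊤ ∧ ∀ c : ℝ,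
      ∫⁻ x, (‖x - c‖ₑ⁻¹) ^ (min a 1 / 2) ∂(gammaMeasure a 1) ≤ C := by
  obtain ⟨K, hK, hpdf⟩ := exists_gammaPDFReal_le ha
  set δ := min a 1 / 2 with hδ
  have hδ0 : 0 < δ := by positivity
  have hδ1 : 2 * δ ≤ 1 := by rw [hδ]; linarith [min_le_right a 1]
  have hb : min a 1 - 1 = 2 * δ - 1 := by rw [hδ]; ring
  rw [hb] at hpdf
  set g : ℝ → ℝ≥0∞ := (Metric.ball (0 : ℝ) 1).indicator
    fun x => ENNReal.ofReal (‖x‖ ^ (δ - 1)) with hg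
  have hgm : Measurable g :=
    (by fun_prop : Measurable fun x : ℝ => ENNReal.ofReal (‖x‖ ^ (δ - 1))).indicator
      measurableSet_ball
  have hgi : ∫⁻ x, g x < ⊤ := by
    rw [hg, lintegral_indicator measurableSet_ball]
    exact lintegral_ball_norm_rpow_lt_top (by linarith)
  have hm : Measurable (gammaPDF a 1) := (measurable_gammaPDFReal a 1).ennreal_ofReal
  have hg0 : ∀ x, ‖x‖ < 1 → g x = ENNReal.ofReal (‖x‖ ^ (δ - 1)) := fun x hx =>
    Set.indicator_of_mem (by simpa using hx) _
  refine ⟨1 + (ENNReal.ofReal K * ∫⁻ x, g x) + ENNReal.ofReal K * ∫⁻ x, g x, ?_, fun c => ?_⟩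
  · have := ENNReal.mul_lt_top (ENNReal.ofReal_lt_top (r := K)) hgi
    simp [this]
  rw [gammaMeasure, lintegral_withDensity_eq_lintegral_mul _ hm (by fun_prop)]
  have hpt : ∀ᵐ x : ℝ, (gammaPDF a 1 * fun x => (‖x - c‖ₑ⁻¹) ^ δ) x ≤
      gammaPDF a 1 x + ENNReal.ofReal K * g x + ENNReal.ofReal K * g (x - c) := by
    filter_upwards [compl_mem_ae_iff.2 (measure_singleton (0 : ℝ)),
      compl_mem_ae_iff.2 (measure_singleton c)] with x hx0 hxc
    have hx0 : x ≠ 0 := hx0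
    have hxc : 0 < ‖x - c‖ := norm_pos_iff.2 (sub_ne_zero.2 hxc)
    rw [Pi.mul_apply]
    rcases hx0.lt_or_gt with hx | hx
    · simp [gammaPDF_of_neg hx]
    have hinv : (‖x - c‖ₑ⁻¹) ^ δ = ENNReal.ofReal (‖x - c‖ ^ (-δ)) := by
      rw [← ofReal_norm, ← ENNReal.ofReal_inv_of_pos hxc,
        ENNReal.ofReal_rpow_of_pos (inv_pos.2 hxc), Real.inv_rpow hxc.le, Real.rpow_neg hxc.le]
    rcases le_or_gt 1 ‖x - c‖ with h1 | h1
    · refine le_trans ?_ (le_add_right (le_add_right le_rfl))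
      refine mul_le_of_le_one_right' ?_
      rw [hinv, ENNReal.ofReal_le_one]
      exact Real.rpow_le_one_of_one_le_of_nonpos h1 (by linarith)
    have hle : gammaPDF a 1 x * (‖x - c‖ₑ⁻¹) ^ δ ≤
        ENNReal.ofReal K * ENNReal.ofReal (x ^ (2 * δ - 1) * ‖x - c‖ ^ (-δ)) := by
      rw [hinv, gammaPDF, ← ENNReal.ofReal_mul (gammaPDFReal_nonneg ha one_pos x),
        ← ENNReal.ofReal_mul hK, ← mul_assoc]
      exact ENNReal.ofReal_le_ofReal
        (mul_le_mul_of_nonneg_right (hpdf x hx) (by positivity))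
    refine hle.trans ?_
    rcases le_total x ‖x - c‖ with h2 | h2
    · refine le_trans ?_ (le_add_right (le_add_left le_rfl))
      have hxn : ‖x‖ = x := Real.norm_of_nonneg hx.le
      rw [hg0 x (by rw [hxn]; linarith), hxn]
      gcongr
      calc x ^ (2 * δ - 1) * ‖x - c‖ ^ (-δ) ≤ x ^ (2 * δ - 1) * x ^ (-δ) :=
            mul_le_mul_of_nonneg_left
              (Real.rpow_le_rpow_of_nonpos hx h2 (by linarith)) (by positivity)
        _ = x ^ (δ - 1) := by rw [← Real.rpow_add hx]; ring_nf
    · refine le_trans ?_ (le_add_left le_rfl)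
      rw [hg0 _ h1]
      gcongr
      calc x ^ (2 * δ - 1) * ‖x - c‖ ^ (-δ) ≤ ‖x - c‖ ^ (2 * δ - 1) * ‖x - c‖ ^ (-δ) :=
            mul_le_mul_of_nonneg_right
              (Real.rpow_le_rpow_of_nonpos hxc h2 (by linarith)) (by positivity)
        _ = ‖x - c‖ ^ (δ - 1) := by rw [← Real.rpow_add hxc]; ring_nf
  refine (lintegral_mono_ae hpt).trans_eq ?_
  rw [lintegral_add_left (by fun_prop), lintegral_add_left hm, lintegral_const_mul _ hgm,
    lintegral_const_mul _ (by fun_prop), lintegral_sub_right_eq_self,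
    lintegral_gammaPDF_eq_one ha one_pos]

/-- Integrate over the `k`-th weight first. With the others frozen, the sum is `a k * (t + b)`, and
the one-variable bound is uniform in the shift. -/
theorem lintegral_pi_inv_rpow_sum_le {ι : Type*} [Fintype ι] [DecidableEq ι] (ν : Measure ℝ)
    [IsProbabilityMeasure ν] {δ : ℝ} (hδ : 0 ≤ δ) {C : ℝ≥0∞}
    (hC : ∀ c : ℝ, ∫⁻ x, (‖x - c‖ₑ⁻¹) ^ δ ∂ν ≤ C) (a : ι → ℂ) (k : ι) (hk : a k ≠ 0) :
    ∫⁻ w, (‖∑ i, (w i : ℂ) * a i‖ₑ⁻¹) ^ δ ∂(Measure.pi fun _ : ι => ν) ≤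
      (‖a k‖ₑ⁻¹) ^ δ * C := by
  have hmeas : Measurable fun w : ι → ℝ => (‖∑ i, (w i : ℂ) * a i‖ₑ⁻¹) ^ δ := by fun_prop
  have ha0 : ‖a k‖ₑ ≠ 0 := by simpa using hk
  rw [lintegral_eq_lmarginal_univ (fun _ => 0), lmarginal_erase' _ hmeas (Finset.mem_univ k)]
  have hinner : ∀ w : ι → ℝ,
      ∫⁻ t, (‖∑ i, ((Function.update w k t i : ℝ) : ℂ) * a i‖ₑ⁻¹) ^ δ ∂ν ≤
        (‖a k‖ₑ⁻¹) ^ δ * C := by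
    intro w
    set b := (∑ i ∈ Finset.univ.erase k, (w i : ℂ) * a i) / a k with hb
    have hsum : ∀ t : ℝ, ∑ i, ((Function.update w k t i : ℝ) : ℂ) * a i = a k * (t + b) := by
      intro t
      rw [← Finset.add_sum_erase _ _ (Finset.mem_univ k), Function.update_self, mul_add, hb,
        mul_div_cancel₀ _ hk, mul_comm (a k)]
      congr 1
      refine Finset.sum_congr rfl fun i hi => ?_
      rw [Function.update_of_ne (Finset.ne_of_mem_erase hi)]
    -- The shift `b` is complex but the weight is real: `‖t + b‖` is at least `|t + b.re|`.
    have hle : ∀ t : ℝ, (‖∑ i, ((Function.update w k t i : ℝ) : ℂ) * a i‖ₑ⁻¹) ^ δ ≤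
        (‖a k‖ₑ⁻¹) ^ δ * (‖t - -b.re‖ₑ⁻¹) ^ δ := by
      intro t
      rw [hsum, enorm_mul, ENNReal.mul_inv (Or.inl ha0) (Or.inl enorm_ne_top),
        ENNReal.mul_rpow_of_nonneg _ _ hδ]
      gcongr
      rw [← ofReal_norm, ← ofReal_norm]
      refine ENNReal.ofReal_le_ofReal ?_
      simpa using Complex.abs_re_le_norm (t + b)
    refine (lintegral_mono hle).trans ?_
    rw [lintegral_const_mul _ (by fun_prop)]
    gcongr
    exact hC _
  refine (lmarginal_mono (g := fun _ => (‖a k‖ₑ⁻¹) ^ δ * C) hinner _).trans ?_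
  simp [lmarginal]

/-! ### Moments of the Cauchy sum under independent weights -/

theorem indepFun_prodMk_of_indepFun_prodMk {Ω α β γ : Type*} [MeasurableSpace Ω]
    [MeasurableSpace α] [MeasurableSpace β] [MeasurableSpace γ] {P : Measure Ω}
    [IsProbabilityMeasure P] {X : Ω → α} {U : Ω → β} {V : Ω → γ} (hX : Measurable X)
    (hU : Measurable U) (hV : Measurable V) (h : IndepFun X (fun ω => (U ω, V ω)) P)
    (hUV : IndepFun U V P) : IndepFun (fun ω => (X ω, U ω)) V P := by
  have := Measure.isProbabilityMeasure_map (μ := P) hX.aemeasurable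
  have := Measure.isProbabilityMeasure_map (μ := P) hU.aemeasurable
  have := Measure.isProbabilityMeasure_map (μ := P) hV.aemeasurable
  have hXU : IndepFun X U P := h.comp measurable_id measurable_fst
  rw [indepFun_iff_map_prod_eq_prod_map_map (by fun_prop) (by fun_prop)] at h hUV hXU ⊢
  rw [hXU]
  apply (MeasurableEquiv.prodAssoc (α := α) (β := β) (γ := γ)).map_measurableEquiv_injective
  rw [Measure.prodAssoc_prod, ← hUV, ← h, Measure.map_map (by fun_prop) (by fun_prop)]
  rfl

/-- An upper bound for the local `L¹` norm of `log ‖weightedCauchySum w z ·‖`, up to a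
logarithmic term. -/
noncomputable def cauchyMoment {ι : Type*} [Fintype ι] (δ ρ : ℝ) (w : ι → ℝ) (z : ι → ℂ) : ℝ≥0∞ :=
  ∫⁻ x in Metric.closedBall (0 : ℂ) ρ,
    (‖weightedCauchySum w z x‖ₑ + ENNReal.ofReal δ⁻¹ * (‖weightedCauchySum w z x‖ₑ⁻¹) ^ δ)

theorem measurable_weightedCauchySum {ι : Type*} [Fintype ι] :
    Measurable fun p : ((ι → ℂ) × (ι → ℝ)) × ℂ => weightedCauchySum p.1.2 p.1.1 p.2 := by
  unfold weightedCauchySum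
  fun_prop

theorem measurable_weightedCauchySum_right {ι : Type*} [Fintype ι] (w : ι → ℝ) (z : ι → ℂ) :
    Measurable (weightedCauchySum w z) := by
  unfold weightedCauchySum
  fun_prop

theorem measurable_cauchyMoment {ι : Type*} [Fintype ι] (δ ρ : ℝ) :
    Measurable fun p : (ι → ℂ) × (ι → ℝ) => cauchyMoment δ ρ p.2 p.1 := by
  have := measurable_weightedCauchySum (ι := ι)
  unfold cauchyMoment
  refine Measurable.lintegral_prod_right' (f := fun p : ((ι → ℂ) × (ι → ℝ)) × ℂ =>
    ‖weightedCauchySum p.1.2 p.1.1 p.2‖ₑ +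
      ENNReal.ofReal δ⁻¹ * (‖weightedCauchySum p.1.2 p.1.1 p.2‖ₑ⁻¹) ^ δ) ?_
  fun_prop

theorem lintegral_enorm_log_weightedCauchySum_le {ι : Type*} [Fintype ι] {L δ : ℝ} (hL : 0 ≤ L)
    (hδ : 0 < δ) (ρ : ℝ) (w : ι → ℝ) (z : ι → ℂ) :
    ∫⁻ x in Metric.closedBall (0 : ℂ) ρ, ‖Real.log ‖weightedCauchySum w z x‖‖ₑ ≤
      ENNReal.ofReal (L * (1 + δ⁻¹)) * volume (Metric.closedBall (0 : ℂ) ρ) +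
        ENNReal.ofReal (Real.exp (-L)) * cauchyMoment δ ρ w z := by
  have hS := measurable_weightedCauchySum_right w z
  rw [cauchyMoment, ← setLIntegral_const, ← lintegral_const_mul _ (by fun_prop),
    ← lintegral_add_left measurable_const]
  refine lintegral_mono fun x => ?_
  set S := weightedCauchySum w z x
  -- Here `Real.log 0 = 0`, so the left side vanishes.
  by_cases h0 : S = 0
  · simp [h0]
  have hs : 0 < ‖S‖ := norm_pos_iff.2 h0
  have h := ENNReal.ofReal_le_ofReal (abs_log_le hL hδ hs)
  rw [Real.enorm_eq_ofReal_abs]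
  refine h.trans_eq ?_
  rw [ENNReal.ofReal_add (by positivity) (by positivity), ENNReal.ofReal_mul (Real.exp_pos _).le,
    ENNReal.ofReal_add (by positivity) (by positivity), ENNReal.ofReal_mul (by positivity : 0 ≤ δ⁻¹),
    ← ENNReal.ofReal_rpow_of_pos (inv_pos.2 hs), ENNReal.ofReal_inv_of_pos hs, ofReal_norm]

theorem lintegral_enorm_weightedCauchySum_le {ι : Type*} [Fintype ι] {ρ : ℝ} {C : ℝ≥0∞}
    (hC : ∀ w : ℂ, ∫⁻ z in Metric.closedBall (0 : ℂ) ρ, ‖z - w‖ₑ⁻¹ ≤ C) (w : ι → ℝ) (z : ι → ℂ) :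
    ∫⁻ x in Metric.closedBall (0 : ℂ) ρ, ‖weightedCauchySum w z x‖ₑ ≤ (∑ k, ‖w k‖ₑ) * C := by
  calc _ ≤ ∫⁻ x in Metric.closedBall (0 : ℂ) ρ, ∑ k, ‖w k‖ₑ * ‖x - z k‖ₑ⁻¹ := by
        refine lintegral_mono_ae (ae_restrict_of_ae ?_)
        filter_upwards [ae_forall_ne z] with x hx
        refine (enorm_sum_le _ _).trans_eq (Finset.sum_congr rfl fun k _ => ?_)
        rw [enorm_mul, enorm_inv (sub_ne_zero.2 (hx k))]
        congr 1
        rw [← ofReal_norm, Complex.norm_real, ofReal_norm]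
    _ = ∑ k, ‖w k‖ₑ * ∫⁻ x in Metric.closedBall (0 : ℂ) ρ, ‖x - z k‖ₑ⁻¹ := by
        rw [lintegral_finsetSum _ fun k _ => by fun_prop]
        exact Finset.sum_congr rfl fun k _ => lintegral_const_mul _ (by fun_prop)
    _ ≤ _ := by
        rw [Finset.sum_mul]
        exact Finset.sum_le_sum fun k _ => mul_le_mul' le_rfl (hC _)

/-- The singled-out weight belongs to a point `z k` of least modulus. Its coefficient `(x - z k)⁻¹`
contributes `‖x - z k‖ ^ δ`, which is at most `1 + ‖x‖ + ‖z k‖` because `δ ≤ 1`. -/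
theorem lintegral_pi_inv_rpow_weightedCauchySum_le {ι : Type*} [Fintype ι] [Nonempty ι]
    (ν : Measure ℝ) [IsProbabilityMeasure ν] {δ : ℝ} (hδ : 0 ≤ δ) (hδ1 : δ ≤ 1) {C : ℝ≥0∞}
    (hC : ∀ c : ℝ, ∫⁻ x, (‖x - c‖ₑ⁻¹) ^ δ ∂ν ≤ C) (z : ι → ℂ) {x : ℂ} (hx : ∀ k, x ≠ z k) :
    ∫⁻ w, (‖weightedCauchySum w z x‖ₑ⁻¹) ^ δ ∂(Measure.pi fun _ : ι => ν) ≤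
      (1 + ‖x‖ₑ + ⨅ k, ‖z k‖ₑ) * C := by
  classical
  obtain ⟨k, hk⟩ := exists_eq_ciInf_of_finite (f := fun k => ‖z k‖ₑ)
  have hk0 : x - z k ≠ 0 := sub_ne_zero.2 (hx k)
  refine (lintegral_pi_inv_rpow_sum_le ν hδ hC (fun k => (x - z k)⁻¹) k (inv_ne_zero hk0)).trans ?_
  gcongr
  rw [enorm_inv hk0, inv_inv, ← hk]
  calc ‖x - z k‖ₑ ^ δ ≤ (1 + ‖x - z k‖ₑ) ^ δ := by gcongr; exact le_add_self
    _ ≤ (1 + ‖x - z k‖ₑ) ^ (1 : ℝ) := ENNReal.rpow_le_rpow_of_exponent_le le_self_add hδ1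
    _ ≤ _ := by
      rw [ENNReal.rpow_one, add_assoc]
      gcongr
      exact enorm_sub_le

theorem exists_lintegral_pi_cauchyMoment_le {a : ℝ} (ha : 0 < a) (ρ : ℝ) :
    ∃ C : ℝ≥0∞, C < ⊤ ∧ ∀ (N : ℕ), 0 < N → ∀ z : Fin N → ℂ,
      ∫⁻ w, cauchyMoment (min a 1 / 2) ρ w z ∂(Measure.pi fun _ : Fin N => gammaMeasure a 1) ≤
        C * (N + 1 + ⨅ k, ‖z k‖ₑ) := by
  have hprob := isProbabilityMeasure_gammaMeasure ha one_pos
  obtain ⟨C₁, hC₁, hball⟩ := exists_forall_lintegral_inv_enorm_sub_le ρ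
  obtain ⟨C₂, hC₂, hanti⟩ := exists_lintegral_gammaMeasure_inv_rpow_le ha
  have hδ0 : 0 < min a 1 / 2 := by positivity
  have hδ1 : min a 1 / 2 ≤ 1 := by linarith [min_le_right a 1]
  set δ := min a 1 / 2
  set E := ∫⁻ x, ‖x‖ₑ ∂(gammaMeasure a 1) with hE
  have hE' : E < ⊤ := lintegral_enorm_gammaMeasure_lt_top ha
  set V := volume (Metric.closedBall (0 : ℂ) ρ) with hV
  have hV' : V < ⊤ := measure_closedBall_lt_top
  set D := ENNReal.ofReal δ⁻¹ * (C₂ * V * (1 + ENNReal.ofReal ρ)) with hD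
  have hD' : D < ⊤ := by
    refine ENNReal.mul_lt_top ENNReal.ofReal_lt_top (ENNReal.mul_lt_top
      (ENNReal.mul_lt_top hC₂ hV') ?_)
    simp
  refine ⟨E * C₁ + D, ENNReal.add_lt_top.2 ⟨ENNReal.mul_lt_top hE' hC₁, hD'⟩, fun N hN z => ?_⟩
  have : Nonempty (Fin N) := ⟨⟨0, hN⟩⟩
  set π := Measure.pi fun _ : Fin N => gammaMeasure a 1
  have hSm := measurable_weightedCauchySum (ι := Fin N)
  have hS : Measurable fun p : (Fin N → ℝ) × ℂ => weightedCauchySum p.1 z p.2 :=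
    hSm.comp (by fun_prop : Measurable fun p : (Fin N → ℝ) × ℂ => ((z, p.1), p.2))
  have h1 : ∫⁻ w, (∫⁻ x in Metric.closedBall (0 : ℂ) ρ, ‖weightedCauchySum w z x‖ₑ) ∂π ≤
      E * C₁ * N := by
    refine (lintegral_mono fun w => lintegral_enorm_weightedCauchySum_le hball w z).trans ?_
    rw [lintegral_mul_const _ (by fun_prop), lintegral_finsetSum _ fun k _ => by fun_prop]
    have : ∀ k, ∫⁻ w : Fin N → ℝ, ‖w k‖ₑ ∂π = E := fun k =>
      (measurePreserving_eval (fun _ : Fin N => gammaMeasure a 1) k).lintegral_comp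
        (f := fun x => ‖x‖ₑ) (by fun_prop)
    simp only [this, Finset.sum_const, Finset.card_univ, Fintype.card_fin, nsmul_eq_mul]
    exact le_of_eq (by ring)
  have h2 : ∫⁻ w, (∫⁻ x in Metric.closedBall (0 : ℂ) ρ,
      (‖weightedCauchySum w z x‖ₑ⁻¹) ^ δ) ∂π ≤
      C₂ * V * (1 + ENNReal.ofReal ρ + ⨅ k, ‖z k‖ₑ) := by
    rw [lintegral_lintegral_swap (by fun_prop)]
    calc _ ≤ ∫⁻ x in Metric.closedBall (0 : ℂ) ρ, (1 + ENNReal.ofReal ρ + ⨅ k, ‖z k‖ₑ) * C₂ := by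
          refine setLIntegral_mono_ae measurable_const.aemeasurable ?_
          filter_upwards [ae_forall_ne z] with x hx hxρ
          refine (lintegral_pi_inv_rpow_weightedCauchySum_le _ hδ0.le hδ1 hanti z hx).trans ?_
          gcongr
          rw [← ofReal_norm]
          exact ENNReal.ofReal_le_ofReal (by simpa using hxρ)
      _ = _ := by rw [setLIntegral_const]; ring
  have h3 : ∀ w : Fin N → ℝ, cauchyMoment δ ρ w z =
      (∫⁻ x in Metric.closedBall (0 : ℂ) ρ, ‖weightedCauchySum w z x‖ₑ) + ENNReal.ofReal δ⁻¹ *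
        ∫⁻ x in Metric.closedBall (0 : ℂ) ρ, (‖weightedCauchySum w z x‖ₑ⁻¹) ^ δ := by
    intro w
    have := measurable_weightedCauchySum_right w z
    rw [cauchyMoment, lintegral_add_left (by fun_prop), lintegral_const_mul _ (by fun_prop)]
  have hm1 : Measurable fun w => ∫⁻ x in Metric.closedBall (0 : ℂ) ρ,
      ‖weightedCauchySum w z x‖ₑ := by
    refine Measurable.lintegral_prod_right' (f := fun p : (Fin N → ℝ) × ℂ =>
      ‖weightedCauchySum p.1 z p.2‖ₑ) ?_
    fun_prop
  simp_rw [h3]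
  rw [lintegral_add_left hm1, lintegral_const_mul' _ _ ENNReal.ofReal_ne_top]
  calc _ ≤ E * C₁ * N + ENNReal.ofReal δ⁻¹ * (C₂ * V * (1 + ENNReal.ofReal ρ + ⨅ k, ‖z k‖ₑ)) := by
        gcongr
    _ ≤ E * C₁ * N + D * (1 + ⨅ k, ‖z k‖ₑ) := by
        rw [hD, mul_assoc (ENNReal.ofReal δ⁻¹), mul_assoc (C₂ * V)]
        gcongr
        rw [mul_add, mul_one]
        gcongr
        exact le_mul_of_one_le_left' (le_self_add)
    _ ≤ (E * C₁) * (N + 1 + ⨅ k, ‖z k‖ₑ) + D * (N + 1 + ⨅ k, ‖z k‖ₑ) := by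
        gcongr
        · rw [add_assoc]; exact le_self_add
        · exact le_add_self
    _ = _ := by ring

/-! ### Independence of the current points and the next weights -/

namespace IsIteratedRandomizedDerivative

variable {Ω : Type*} [MeasurableSpace Ω] {P : Measure Ω} {β : ℝ} {n m : ℕ}
  {Z : (j : ℕ) → Fin (n - j) → Ω → ℂ} {γ : (j : ℕ) → Fin (n - j) → Ω → ℝ}

theorem pastSigmaAlgebra_le (h : IsIteratedRandomizedDerivative P β n m Z γ) {j : ℕ} (hj : j ≤ m) :
    pastSigmaAlgebra Z γ j ≤ ‹MeasurableSpace Ω› :=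
  sup_le (iSup_le fun k => (h.measurable_init k).comap_le)
    (iSup_le fun i => iSup_le fun hi => iSup_le fun k =>
      (h.measurable_weight i (hi.trans_le hj) k).comap_le)

theorem measurable_past (h : IsIteratedRandomizedDerivative P β n m Z γ) {j : ℕ} (hj : j ≤ m)
    (k : Fin (n - j)) : Measurable[pastSigmaAlgebra Z γ j] (Z j k) := by
  cases j with
  | zero =>
    exact (comap_measurable (Z 0 k)).mono
      ((le_iSup (fun k => MeasurableSpace.comap (Z 0 k) inferInstance) k).trans le_sup_left) le_rfl
  | succ j => exact h.measurable_step j (Nat.lt_of_succ_le hj) k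

theorem measurable_points (h : IsIteratedRandomizedDerivative P β n m Z γ) {j : ℕ} (hj : j ≤ m)
    (k : Fin (n - j)) : Measurable (Z j k) :=
  (h.measurable_past hj k).mono (h.pastSigmaAlgebra_le hj) le_rfl

theorem measurable_cauchyMoment (h : IsIteratedRandomizedDerivative P β n m Z γ) {j : ℕ}
    (hj : j < m) (δ ρ : ℝ) :
    Measurable fun ω => cauchyMoment δ ρ (fun k => γ j k ω) (fun k => Z j k ω) := by
  have hZ : Measurable fun ω k => Z j k ω := measurable_pi_iff.2 (h.measurable_points hj.le)
  have hγ : Measurable fun ω k => γ j k ω := measurable_pi_iff.2 (h.measurable_weight j hj)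
  have hF := _root_.measurable_cauchyMoment (ι := Fin (n - j)) δ ρ
  generalize hF' : (fun p : (Fin (n - j) → ℂ) × (Fin (n - j) → ℝ) => cauchyMoment δ ρ p.2 p.1) = F
    at hF
  have : (fun ω => cauchyMoment δ ρ (fun k => γ j k ω) (fun k => Z j k ω)) =
      fun ω => F (fun k => Z j k ω, fun k => γ j k ω) := by rw [← hF']
  rw [this]
  exact hF.comp (hZ.prodMk hγ)

/-- The points `Z j` are measurable with respect to the initial points and the weights of steps
before `j`. That σ-algebra is independent of the weights of step `j`; measurable labelling of the
zeros is essential here. -/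
theorem indepFun_points_weights [IsProbabilityMeasure P]
    (h : IsIteratedRandomizedDerivative P β n m Z γ) {j : ℕ} (hj : j < m) :
    IndepFun (fun ω k => Z j k ω) (fun ω k => γ j k ω) P := by
  classical
  let G : (Σ j : Fin m, Fin (n - j)) → Ω → ℝ := fun p => γ p.1 p.2
  have hG : ∀ p, Measurable (G p) := fun p => h.measurable_weight p.1 p.1.2 p.2
  let A : Finset (Σ j : Fin m, Fin (n - j)) := Finset.univ.filter fun p => p.1.1 < j
  let B : Finset (Σ j : Fin m, Fin (n - j)) := Finset.univ.filter fun p => p.1.1 = j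
  have hAB : Disjoint A B := by
    rw [Finset.disjoint_left]
    intro p hp hp'
    simp only [A, B, Finset.mem_filter] at hp hp'
    omega
  have hUV := h.iIndepFun_weight.indepFun_finset A B hAB hG
  have hX : Measurable fun ω k => Z 0 k ω := measurable_pi_iff.2 h.measurable_init
  have hXUV : IndepFun (fun ω k => Z 0 k ω)
      (fun ω => ((fun p : A => G p ω), fun p : B => G p ω)) P :=
    h.indepFun_init_weight.comp (φ := id)
      (ψ := fun g : (Σ j : Fin m, Fin (n - j)) → ℝ => ((fun p : A => g p), fun p : B => g p))
      measurable_id (by fun_prop)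
  have hmain := indepFun_prodMk_of_indepFun_prodMk hX (by fun_prop) (by fun_prop) hXUV hUV
  have hγ : IndepFun (fun ω => ((fun k => Z 0 k ω), fun p : A => G p ω))
      (fun ω k => γ j k ω) P := by
    have hmem : ∀ k : Fin (n - j), (⟨⟨j, hj⟩, k⟩ : Σ j : Fin m, Fin (n - j)) ∈ B := fun k => by
      simp [B]
    exact hmain.comp (φ := id) (ψ := fun g k => g ⟨⟨⟨j, hj⟩, k⟩, hmem k⟩) measurable_id
      (by fun_prop)
  rw [IndepFun_iff_Indep] at hγ ⊢
  refine indep_of_indep_of_le_left hγ ?_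
  have hpast : pastSigmaAlgebra Z γ j ≤ MeasurableSpace.comap
      (fun ω => ((fun k => Z 0 k ω), fun p : A => G p ω)) inferInstance := by
    refine sup_le (iSup_le fun k => ?_) (iSup_le fun i => iSup_le fun hi => iSup_le fun k => ?_)
    · rw [← measurable_iff_comap_le]
      exact (by fun_prop : Measurable fun p : (Fin (n - 0) → ℂ) × (A → ℝ) => p.1 k).comp
        (comap_measurable _)
    · rw [← measurable_iff_comap_le]
      have hmem : (⟨⟨i, hi.trans hj⟩, k⟩ : Σ j : Fin m, Fin (n - j)) ∈ A := by simp [A, hi]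
      exact (by fun_prop : Measurable fun p : (Fin (n - 0) → ℂ) × (A → ℝ) =>
        p.2 ⟨_, hmem⟩).comp (comap_measurable _)
  refine le_trans ?_ hpast
  rw [← measurable_iff_comap_le]
  exact @measurable_pi_lambda _ _ _ (_) _ _ fun k => h.measurable_past hj.le k

theorem map_weights_eq_pi [IsProbabilityMeasure P]
    (h : IsIteratedRandomizedDerivative P β n m Z γ) {j : ℕ} (hj : j < m) :
    P.map (fun ω k => γ j k ω) = Measure.pi fun _ : Fin (n - j) => gammaMeasure (β / 2) 1 := by
  have hinj : Function.Injective
      (fun k : Fin (n - j) => (⟨⟨j, hj⟩, k⟩ : Σ j : Fin m, Fin (n - j))) := by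
    intro k l hkl
    simpa using hkl
  have hind := h.iIndepFun_weight.precomp hinj
  rw [iIndepFun_iff_map_fun_eq_pi_map
    fun k => (h.measurable_weight j hj k).aemeasurable] at hind
  refine hind.trans ?_
  congr with k : 1
  exact (h.hasLaw_weight j hj k).map_eq

theorem lintegral_points_weights_eq [IsProbabilityMeasure P] (hβ : 0 < β)
    (h : IsIteratedRandomizedDerivative P β n m Z γ) {j : ℕ} (hj : j < m)
    {F : (Fin (n - j) → ℂ) × (Fin (n - j) → ℝ) → ℝ≥0∞} (hF : Measurable F) :
    ∫⁻ ω, F (fun k => Z j k ω, fun k => γ j k ω) ∂P =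
      ∫⁻ ω, ∫⁻ w, F (fun k => Z j k ω, w)
        ∂(Measure.pi fun _ : Fin (n - j) => gammaMeasure (β / 2) 1) ∂P := by
  have := isProbabilityMeasure_gammaMeasure (half_pos hβ) one_pos
  have hZ : Measurable fun ω k => Z j k ω := measurable_pi_iff.2 (h.measurable_points hj.le)
  have hγ : Measurable fun ω k => γ j k ω := measurable_pi_iff.2 (h.measurable_weight j hj)
  have hmap := (h.indepFun_points_weights hj).map_prod_eq_prod_map_map hZ.aemeasurable
    hγ.aemeasurable
  rw [h.map_weights_eq_pi hj] at hmap
  rw [← lintegral_map hF (hZ.prodMk hγ), hmap, lintegral_prod _ hF.aemeasurable,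
    lintegral_map hF.lintegral_prod_right' hZ]

end IsIteratedRandomizedDerivative

theorem exists_lintegral_cauchyMoment_le {β : ℝ} (hβ : 0 < β) (ρ : ℝ) :
    ∃ C : ℝ≥0∞, C < ⊤ ∧ ∀ {Ω : Type*} [MeasurableSpace Ω] (P : Measure Ω)
      [IsProbabilityMeasure P] {n m : ℕ} {Z : (j : ℕ) → Fin (n - j) → Ω → ℂ}
      {γ : (j : ℕ) → Fin (n - j) → Ω → ℝ}, IsIteratedRandomizedDerivative P β n m Z γ →
      ∀ j < m, j < n →
      ∫⁻ ω, cauchyMoment (min (β / 2) 1 / 2) ρ (fun k => γ j k ω) (fun k => Z j k ω) ∂P ≤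
        C * (n + 1 + ∫⁻ ω, ⨅ k, ‖Z j k ω‖ₑ ∂P) := by
  obtain ⟨C, hC, hle⟩ := exists_lintegral_pi_cauchyMoment_le (half_pos hβ) ρ
  refine ⟨C, hC, fun P _ n m Z γ h j hj hjn => ?_⟩
  have hZ := h.measurable_points hj.le
  rw [h.lintegral_points_weights_eq hβ hj (measurable_cauchyMoment _ ρ)]
  refine (lintegral_mono fun ω => hle (n - j) (by omega) fun k => Z j k ω).trans ?_
  rw [lintegral_const_mul' _ _ hC.ne, lintegral_add_left measurable_const, lintegral_const,
    measure_univ, mul_one]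
  gcongr
  omega

/-! ### From vague to weak convergence -/

/-- The function equal to `1` on the ball of radius `k`, vanishing outside the ball of radius
`k + 1`, and radially affine in between. -/
noncomputable def radialCutoff (k : ℕ) (x : ℂ) : ℝ := max 0 (min 1 (k + 1 - ‖x‖))

theorem continuous_radialCutoff (k : ℕ) : Continuous (radialCutoff k) := by
  unfold radialCutoff; fun_prop

theorem radialCutoff_nonneg (k : ℕ) (x : ℂ) : 0 ≤ radialCutoff k x := le_max_left _ _

theorem radialCutoff_le_one (k : ℕ) (x : ℂ) : radialCutoff k x ≤ 1 :=
  max_le zero_le_one (min_le_left _ _)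

theorem hasCompactSupport_radialCutoff (k : ℕ) : HasCompactSupport (radialCutoff k) := by
  refine HasCompactSupport.of_support_subset_isCompact
    (isCompact_closedBall (0 : ℂ) (k + 1)) fun x hx => ?_
  by_contra h
  have h : (k : ℝ) + 1 < ‖x‖ := by simpa using h
  exact hx (max_eq_left ((min_le_right _ _).trans (by linarith)))

theorem tendsto_radialCutoff (x : ℂ) : Tendsto (fun k => radialCutoff k x) atTop (𝓝 1) := by
  refine tendsto_const_nhds.congr' ?_
  filter_upwards [eventually_ge_atTop ⌈‖x‖⌉₊] with k hk
  have : ‖x‖ ≤ k := (Nat.le_ceil _).trans (by exact_mod_cast hk)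
  rw [radialCutoff, min_eq_left (by linarith), max_eq_right zero_le_one]

theorem tendsto_integral_radialCutoff (μ : FiniteMeasure ℂ) :
    Tendsto (fun k => ∫ x, radialCutoff k x ∂(μ : Measure ℂ)) atTop
      (𝓝 ((μ : Measure ℂ).real Set.univ)) := by
  have h := tendsto_integral_of_dominated_convergence (μ := (μ : Measure ℂ)) (fun _ : ℂ => (1 : ℝ))
    (F := radialCutoff) (f := fun _ => 1)
    (fun k => (continuous_radialCutoff k).aestronglyMeasurable) (integrable_const 1)
    (fun k => ae_of_all _ fun x => by
      rw [Real.norm_of_nonneg (radialCutoff_nonneg k x)]; exact radialCutoff_le_one k x)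
    (ae_of_all _ tendsto_radialCutoff)
  simpa using h

/-- Measures of mass one which are vaguely asymptotic to a weakly convergent sequence of
measures of mass one converge weakly to the same limit. -/
theorem tendsto_of_forall_integral_sub_tendsto_zero {μs νs : ℕ → FiniteMeasure ℂ}
    {μ : FiniteMeasure ℂ} (hν : Tendsto νs atTop (𝓝 μ))
    (hμ1 : ∀ᶠ n in atTop, (μs n).mass = 1) (hν1 : ∀ᶠ n in atTop, (νs n).mass = 1)
    (h : ∀ f : ℂ → ℝ, Continuous f → HasCompactSupport f →
      Tendsto (fun n => ∫ x, f x ∂(μs n : Measure ℂ) - ∫ x, f x ∂(νs n : Measure ℂ)) atTop (𝓝 0)) :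
    Tendsto μs atTop (𝓝 μ) := by
  have hνμ := hν
  rw [FiniteMeasure.tendsto_iff_forall_integral_tendsto] at hν ⊢
  intro g
  suffices hs : Tendsto (fun n => ∫ x, g x ∂(μs n : Measure ℂ) - ∫ x, g x ∂(νs n : Measure ℂ))
      atTop (𝓝 0) by simpa using hs.add (hν g)
  have hint : ∀ (τ : FiniteMeasure ℂ) (f : ℂ → ℝ) (C : ℝ), Continuous f → (∀ x, ‖f x‖ ≤ C) →
      Integrable f (τ : Measure ℂ) := fun τ f C hf hC =>
    Integrable.of_bound hf.aestronglyMeasurable C (ae_of_all _ hC)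
  have hmass : ∀ τ : FiniteMeasure ℂ, τ.mass = 1 → (τ : Measure ℂ).real Set.univ = 1 := by
    intro τ hτ
    rw [measureReal_def, ← FiniteMeasure.ennreal_mass, hτ]
    simp
  have hμmass : (μ : Measure ℂ).real Set.univ = 1 := by
    exact hmass μ (tendsto_nhds_unique hνμ.mass
      (tendsto_const_nhds.congr' (hν1.mono fun _ h => h.symm)))
  have hχ : ∀ k x, ‖radialCutoff k x‖ ≤ 1 := fun k x => by
    rw [Real.norm_of_nonneg (radialCutoff_nonneg k x)]; exact radialCutoff_le_one k x
  have hbound : ∀ k (τ : FiniteMeasure ℂ), τ.mass = 1 →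
      |∫ x, g x ∂(τ : Measure ℂ) - ∫ x, g x * radialCutoff k x ∂(τ : Measure ℂ)| ≤
        ‖g‖ * (1 - ∫ x, radialCutoff k x ∂(τ : Measure ℂ)) := by
    intro k τ hτ
    have hc := continuous_radialCutoff k
    have i1 := hint τ g ‖g‖ g.continuous g.norm_coe_le_norm
    have i2 := hint τ (radialCutoff k) 1 hc (hχ k)
    have i3 := hint τ (fun x => g x * radialCutoff k x) ‖g‖ (g.continuous.mul hc) fun x => by
      rw [norm_mul]
      exact mul_le_of_le_one_right (norm_nonneg _) (hχ k x) |>.trans (g.norm_coe_le_norm x)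
    rw [← integral_sub i1 i3, ← Real.norm_eq_abs]
    have i4 : Integrable (fun x => ‖g‖ * (1 - radialCutoff k x)) (τ : Measure ℂ) :=
      ((integrable_const 1).sub i2).const_mul _
    refine (norm_integral_le_of_norm_le i4 (ae_of_all _ fun x => ?_)).trans_eq ?_
    · rw [show g x - g x * radialCutoff k x = g x * (1 - radialCutoff k x) by ring, norm_mul,
        Real.norm_of_nonneg (sub_nonneg.2 (radialCutoff_le_one k x))]
      exact mul_le_mul_of_nonneg_right (g.norm_coe_le_norm x)
        (sub_nonneg.2 (radialCutoff_le_one k x))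
    · rw [integral_const_mul, integral_sub (integrable_const 1) i2, integral_const, hmass τ hτ]
      simp
  rw [Metric.tendsto_nhds]
  intro ε hε
  -- The budget is `2 * η` for the tail of `μs n`, `η` for the tail of `νs n`, both weighted by
  -- `‖g‖`, and `η` for the truncated test function. The tail of `μs n` is controlled by comparing
  -- the cutoff integrals with those of `νs n`.
  obtain ⟨η, hη, hηε⟩ : ∃ η > 0, ‖g‖ * (3 * η) + η < ε := by
    refine ⟨ε / (2 * (3 * ‖g‖ + 1)), by positivity, ?_⟩
    have : ‖g‖ * (3 * (ε / (2 * (3 * ‖g‖ + 1)))) + ε / (2 * (3 * ‖g‖ + 1)) = ε / 2 := by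
      field_simp
    linarith
  obtain ⟨k, hk⟩ := ((tendsto_order.1 (tendsto_integral_radialCutoff μ)).1 (1 - η)
    (by rw [hμmass]; linarith)).exists
  have hc := continuous_radialCutoff k
  have hν' := hν (BoundedContinuousFunction.ofNormedAddCommGroup (radialCutoff k) hc 1 (hχ k))
  simp only [BoundedContinuousFunction.coe_ofNormedAddCommGroup] at hν'
  have hgk := h (fun x => g x * radialCutoff k x) (g.continuous.mul hc)
    ((hasCompactSupport_radialCutoff k).mul_left)
  have hk' := h (radialCutoff k) hc (hasCompactSupport_radialCutoff k)
  rw [Metric.tendsto_nhds] at hgk hk'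
  filter_upwards [(tendsto_order.1 hν').1 _ hk, hgk η hη, hk' η hη, hμ1, hν1] with n e1 e2 e3 e4 e5
  rw [Real.dist_0_eq_abs] at e2 e3 ⊢
  have b1 := abs_le.1 (hbound k (μs n) e4)
  have b2 := abs_le.1 (hbound k (νs n) e5)
  have e2 := abs_lt.1 e2
  have e3 := abs_lt.1 e3
  have c1 : ‖g‖ * (1 - ∫ x, radialCutoff k x ∂(μs n : Measure ℂ)) ≤ ‖g‖ * (2 * η) :=
    mul_le_mul_of_nonneg_left (by linarith) (norm_nonneg g)
  have c2 : ‖g‖ * (1 - ∫ x, radialCutoff k x ∂(νs n : Measure ℂ)) ≤ ‖g‖ * η :=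
    mul_le_mul_of_nonneg_left (by linarith) (norm_nonneg g)
  rw [abs_lt]
  constructor <;> linarith

/-! ### Empirical measures and smoothed sums -/

theorem toMeasure_empiricalMeasure {N : ℕ} (z : Fin N → ℂ) :
    (empiricalMeasure z : Measure ℂ) = (N : ℝ≥0)⁻¹ • ∑ k, Measure.dirac (z k) := by
  rw [empiricalMeasure, FiniteMeasure.toMeasure_smul, FiniteMeasure.toMeasure_sum]
  rfl

theorem mass_empiricalMeasure {N : ℕ} (hN : 0 < N) (z : Fin N → ℂ) :
    (empiricalMeasure z).mass = 1 := by
  rw [← ENNReal.coe_inj, FiniteMeasure.ennreal_mass, toMeasure_empiricalMeasure,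
    Measure.smul_apply, Measure.finsetSum_apply]
  have hN' : (N : ℝ≥0) ≠ 0 := by exact_mod_cast hN.ne'
  simp only [measure_univ, Finset.sum_const, Finset.card_univ, Fintype.card_fin, nsmul_eq_mul,
    mul_one, ENNReal.smul_def, smul_eq_mul, ENNReal.coe_one]
  rw [ENNReal.coe_inv hN', ENNReal.coe_natCast,
    ENNReal.inv_mul_cancel (by exact_mod_cast hN.ne') (ENNReal.natCast_ne_top N)]

theorem integral_empiricalMeasure {N : ℕ} (z : Fin N → ℂ) (f : ℂ → ℝ) :
    ∫ x, f x ∂(empiricalMeasure z : Measure ℂ) = (N : ℝ)⁻¹ * ∑ k, f (z k) := by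
  rw [toMeasure_empiricalMeasure, integral_smul_nnreal_measure, integral_finsetSum_measure]
  · simp [integral_dirac, NNReal.smul_def]
  · exact fun k _ => integrable_dirac (by simp)

theorem abs_sum_sub_sum_logSmooth_le {ι : Type*} [Fintype ι] {R ε : ℝ}
    (hR : 0 < R) {f : ℂ → ℝ} (hf : Continuous f) (h : ∀ c w, ‖c - w‖ < R → |f c - f w| ≤ ε)
    (a : ι → ℂ) :
    |∑ i, f (a i) - (∫ v, logBump R v)⁻¹ * ∑ i, logSmooth R f (a i)| ≤ Fintype.card ι * ε := by
  set I := ∫ v, logBump R v with hI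
  have hI0 : 0 < I := integral_logBump_pos hR
  rw [Finset.mul_sum, ← Finset.sum_sub_distrib]
  refine (Finset.abs_sum_le_sum_abs _ _).trans ?_
  rw [← nsmul_eq_mul]
  refine Finset.sum_le_card_nsmul _ _ _ fun i _ => ?_
  have := abs_logSmooth_sub_le hR hf (a i) fun c hc => h c (a i) hc
  rw [abs_sub_comm] at this
  rw [show f (a i) - I⁻¹ * logSmooth R f (a i) = I⁻¹ * (I * f (a i) - logSmooth R f (a i)) by
    field_simp, abs_mul, abs_of_pos (inv_pos.2 hI0), inv_mul_le_iff₀ hI0]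
  exact this

theorem abs_sum_sub_sum_le_of_logSmooth {ι κ : Type*} [Fintype ι] [Fintype κ] {R ε : ℝ}
    (hR : 0 < R) {f : ℂ → ℝ} (hf : Continuous f) (h : ∀ c w, ‖c - w‖ < R → |f c - f w| ≤ ε)
    (a : ι → ℂ) (b : κ → ℂ) :
    |∑ i, f (a i) - ∑ i, f (b i)| ≤ (Fintype.card ι + Fintype.card κ) * ε +
      (∫ v, logBump R v)⁻¹ * |∑ i, logSmooth R f (a i) - ∑ i, logSmooth R f (b i)| := by
  have k1 := abs_le.1 (abs_sum_sub_sum_logSmooth_le hR hf h a)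
  have k2 := abs_le.1 (abs_sum_sub_sum_logSmooth_le hR hf h b)
  set I := ∫ v, logBump R v
  have hI0 : 0 < I⁻¹ := inv_pos.2 (integral_logBump_pos hR)
  have habs : I⁻¹ * |∑ i, logSmooth R f (a i) - ∑ i, logSmooth R f (b i)| =
      |I⁻¹ * ∑ i, logSmooth R f (a i) - I⁻¹ * ∑ i, logSmooth R f (b i)| := by
    rw [← mul_sub, abs_mul, abs_of_pos hI0]
  rw [habs]
  have k3 := abs_le.1 (le_refl |I⁻¹ * ∑ i, logSmooth R f (a i) - I⁻¹ * ∑ i, logSmooth R f (b i)|)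
  rw [abs_le]
  constructor <;> linarith

/-- If the sums of every smoothed test function over two families of points are asymptotic, then
so are the integrals of the test function against the empirical measures. -/
theorem tendsto_integral_empiricalMeasure_sub {N N' : ℕ → ℕ} (a : ∀ n, Fin (N' n) → ℂ)
    (b : ∀ n, Fin (N n) → ℂ) (hN : ∀ᶠ n in atTop, 0 < N' n ∧ N' n ≤ N n)
    (hr : Tendsto (fun n => (N' n : ℝ) / N n) atTop (𝓝 1)) {f : ℂ → ℝ} (hf : Continuous f)
    (hfc : HasCompactSupport f)
    (H : ∀ R, 0 < R → R ≤ 1 → Tendsto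
      (fun n => (∑ i, logSmooth R f (a n i) - ∑ i, logSmooth R f (b n i)) / N n) atTop (𝓝 0)) :
    Tendsto (fun n => ∫ x, f x ∂(empiricalMeasure (a n) : Measure ℂ) -
      ∫ x, f x ∂(empiricalMeasure (b n) : Measure ℂ)) atTop (𝓝 0) := by
  obtain ⟨M, hM⟩ := hf.bounded_above_of_compact_support hfc
  have h1 : Tendsto (fun n => (∑ i, f (a n i) - ∑ i, f (b n i)) / N n) atTop (𝓝 0) := by
    rw [Metric.tendsto_nhds]
    intro ε hε
    -- The two families have at most `2 * N n` points, so smoothing costs at most `ε / 2 * N n`; the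
    -- smoothed difference costs less than `ε / 4 * N n`.
    obtain ⟨r, hr, hr'⟩ := Metric.uniformContinuous_iff.1
      (hfc.uniformContinuous_of_continuous hf) (ε / 4) (by positivity)
    set R := min r 1
    have hR : 0 < R := lt_min hr one_pos
    have hI := integral_logBump_pos hR
    have hosc : ∀ c w, ‖c - w‖ < R → |f c - f w| ≤ ε / 4 := fun c w hcw => by
      have := hr' (a := c) (b := w) (by rw [dist_eq_norm]; exact hcw.trans_le (min_le_left _ _))
      rw [Real.dist_eq] at this
      exact this.le
    filter_upwards [hN, Metric.tendsto_nhds.1 (H R hR (min_le_right _ _))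
      ((∫ v, logBump R v) * (ε / 4)) (by positivity)] with n hn h2
    have hNn : (0 : ℝ) < N n := by exact_mod_cast hn.1.trans_le hn.2
    have hNN : (N' n : ℝ) ≤ N n := by exact_mod_cast hn.2
    rw [Real.dist_0_eq_abs, abs_div, abs_of_pos hNn, div_lt_iff₀ hNn] at h2 ⊢
    have h3 := abs_sum_sub_sum_le_of_logSmooth hR hf hosc (a n) (b n)
    simp only [Fintype.card_fin] at h3
    have h4 : (∫ v, logBump R v)⁻¹ * |∑ i, logSmooth R f (a n i) - ∑ i, logSmooth R f (b n i)| <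
        ε / 4 * N n := by
      rw [inv_mul_lt_iff₀ hI]; linarith
    nlinarith
  have h2 : Tendsto (fun n => M * (1 - (N' n : ℝ) / N n)) atTop (𝓝 0) := by
    simpa using (hr.const_sub 1).const_mul M
  -- This corrects for the sum over `N' n` points having been divided by `N n`.
  have h3 : Tendsto (fun n => (N' n : ℝ)⁻¹ * (∑ i, f (a n i)) * (1 - (N' n : ℝ) / N n))
      atTop (𝓝 0) := by
    refine squeeze_zero_norm' ?_ h2
    filter_upwards [hN] with n hn
    have hNn : (0 : ℝ) < N n := by exact_mod_cast hn.1.trans_le hn.2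
    have hNn' : (0 : ℝ) < N' n := by exact_mod_cast hn.1
    have hNN : (N' n : ℝ) / N n ≤ 1 := (div_le_one hNn).2 (by exact_mod_cast hn.2)
    rw [norm_mul, Real.norm_of_nonneg (sub_nonneg.2 hNN)]
    refine mul_le_mul_of_nonneg_right ?_ (sub_nonneg.2 hNN)
    rw [norm_mul, norm_inv, Real.norm_of_nonneg hNn'.le, inv_mul_le_iff₀ hNn']
    refine (norm_sum_le _ _).trans ?_
    simpa using Finset.sum_le_card_nsmul Finset.univ (fun i => ‖f (a n i)‖) M fun i _ => hM _
  have h4 := h1.add h3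
  rw [add_zero] at h4
  refine h4.congr' ?_
  filter_upwards [hN] with n hn
  have hNn : (N n : ℝ) ≠ 0 := by exact_mod_cast (hn.1.trans_le hn.2).ne'
  have hNn' : (N' n : ℝ) ≠ 0 := by exact_mod_cast hn.1.ne'
  rw [integral_empiricalMeasure, integral_empiricalMeasure]
  field_simp
  ring

/-! ### Telescoping over the steps -/

/-- The sum over the steps `j < m` of the local `L¹` norms of the logarithm of the weighted
logarithmic derivatives. -/
noncomputable def totalLogVariation {n : ℕ} (m : ℕ) (ρ : ℝ) (z : (j : ℕ) → Fin (n - j) → ℂ)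
    (w : (j : ℕ) → Fin (n - j) → ℝ) : ℝ≥0∞ :=
  ∑ j ∈ Finset.range m, ∫⁻ x in Metric.closedBall (0 : ℂ) ρ,
    ‖Real.log ‖weightedCauchySum (w j) (z j) x‖‖ₑ

theorem enorm_sum_logSmooth_iterate_sub_le {n m : ℕ} (hmn : m < n)
    {z : (j : ℕ) → Fin (n - j) → ℂ} {w : (j : ℕ) → Fin (n - j) → ℝ}
    (h : ∀ j < m, Finset.univ.val.map (z (j + 1)) = (randomizedDerivative (w j) (z j)).roots)
    {R : ℝ} (hR : 0 < R) (hR1 : R ≤ 1) {f : ℂ → ℝ}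
    (hf : Continuous f) {M : ℝ≥0} (hM : ∀ c, ‖f c‖ₑ ≤ M) {ρ : ℝ}
    (hρ : ∀ c, f c ≠ 0 → c ∈ Metric.closedBall (0 : ℂ) ρ) :
    ‖∑ i, logSmooth R f (z m i) - ∑ i, logSmooth R f (z 0 i)‖ₑ ≤
      2 * M * totalLogVariation m (ρ + 1) z w := by
  rw [← Finset.sum_range_sub (fun j => ∑ i, logSmooth R f (z j i)) m, totalLogVariation,
    Finset.mul_sum]
  refine (enorm_sum_le _ _).trans (Finset.sum_le_sum fun j hj => ?_)
  have hj := Finset.mem_range.1 hj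
  exact enorm_sum_logSmooth_roots_sub_le (by omega) _ _ _ (h j hj) hR hR1 hf hM hρ

theorem tendsto_empiricalMeasure_of_totalLogVariation {m : ℕ → ℕ}
    (hm : ∀ n, 2 ≤ n → m n ≤ n - 1) (hmn : Tendsto (fun n => (m n : ℝ) / n) atTop (𝓝 0))
    {z : (n j : ℕ) → Fin (n - j) → ℂ} {w : (n j : ℕ) → Fin (n - j) → ℝ}
    (hroots : ∀ n, 2 ≤ n → ∀ j < m n, Finset.univ.val.map (z n (j + 1)) =
      (randomizedDerivative (w n j) (z n j)).roots)
    {μ : FiniteMeasure ℂ} (hconv : Tendsto (fun n => empiricalMeasure (z n 0)) atTop (𝓝 μ))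
    (hvar : ∀ ρ : ℕ, Tendsto (fun n : ℕ => totalLogVariation (m n) ρ (z n) (w n) / n)
      atTop (𝓝 0)) :
    Tendsto (fun n => empiricalMeasure (z n (m n))) atTop (𝓝 μ) := by
  have hev : ∀ᶠ n : ℕ in atTop, 2 ≤ n := eventually_ge_atTop 2
  refine tendsto_of_forall_integral_sub_tendsto_zero hconv ?_ ?_ fun f hf hfc => ?_
  · filter_upwards [hev] with n hn
    have := hm n hn
    exact mass_empiricalMeasure (by omega) _
  · filter_upwards [hev] with n hn
    exact mass_empiricalMeasure (by omega) _
  obtain ⟨M, hM⟩ := hf.bounded_above_of_compact_support hfc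
  obtain ⟨r, hr⟩ := hfc.isBounded.subset_closedBall (0 : ℂ)
  obtain ⟨ρ, hρ⟩ := exists_nat_ge r
  have hM' : ∀ c, ‖f c‖ₑ ≤ M.toNNReal := fun c => by
    rw [← ofReal_norm]; exact ENNReal.ofReal_le_ofReal (hM c)
  refine tendsto_integral_empiricalMeasure_sub (N := fun n => n - 0) _ _ ?_ ?_ hf hfc
    fun R hR hR1 => ?_
  · filter_upwards [hev] with n hn
    have := hm n hn
    omega
  · have h1 := hmn.const_sub 1
    rw [sub_zero] at h1
    refine h1.congr' ?_
    filter_upwards [hev] with n hn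
    have := hm n hn
    have hn0 : (n : ℝ) ≠ 0 := by positivity
    rw [Nat.cast_sub (by omega), Nat.sub_zero]
    field_simp
  · rw [tendsto_zero_iff_enorm_tendsto_zero]
    have hlim : Tendsto (fun n : ℕ => 2 * (M.toNNReal : ℝ≥0∞) *
        (totalLogVariation (m n) ((ρ + 1 : ℕ) : ℝ) (z n) (w n) / n)) atTop (𝓝 0) := by
      have := ENNReal.Tendsto.const_mul (a := 2 * (M.toNNReal : ℝ≥0∞)) (hvar (ρ + 1))
        (Or.inr (ENNReal.mul_ne_top (by simp) ENNReal.coe_ne_top))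
      rwa [mul_zero] at this
    refine tendsto_of_tendsto_of_tendsto_of_le_of_le' tendsto_const_nhds hlim
      (Eventually.of_forall fun _ => zero_le) ?_
    filter_upwards [hev] with n hn
    have hmn := hm n hn
    have hn0 : (n : ℝ) ≠ 0 := by positivity
    have h := enorm_sum_logSmooth_iterate_sub_le (by omega) (hroots n hn) hR hR1 hf hM' (ρ := ρ)
      fun c hc => Metric.closedBall_subset_closedBall hρ (hr (subset_tsupport f hc))
    rw [div_eq_mul_inv, enorm_mul, enorm_inv (by simpa using hn0), ← mul_div_assoc,
      div_eq_mul_inv]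
    push_cast
    refine mul_le_mul' h (le_of_eq ?_)
    rw [← ofReal_norm, Nat.sub_zero]
    simp

/-! ### Almost sure control of the total variation -/

theorem ae_forall_le_of_tsum_lintegral_ne_top {Ω : Type*} [MeasurableSpace Ω] {P : Measure Ω}
    {W : ℕ → Ω → ℝ≥0∞} (hW : ∀ n, AEMeasurable (W n) P) (h : ∑' n, ∫⁻ ω, W n ω ∂P ≠ ⊤) :
    ∀ᵐ ω ∂P, ∃ T : ℝ≥0∞, T < ⊤ ∧ ∀ n, W n ω ≤ T := by
  rw [← lintegral_tsum hW] at h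
  filter_upwards [ae_lt_top' (AEMeasurable.tsum hW) h] with ω hω
  exact ⟨_, hω, fun n => ENNReal.le_tsum n⟩

theorem tsum_ofReal_rpow_neg_two_ne_top :
    ∑' n : ℕ, ENNReal.ofReal (((n + 2 : ℕ) : ℝ) ^ (-2 : ℝ)) ≠ ⊤ := by
  have h : Summable fun n : ℕ => ((n + 2 : ℕ) : ℝ) ^ (-2 : ℝ) :=
    (summable_nat_add_iff 2).2 (Real.summable_nat_rpow.2 (by norm_num))
  exact h.tsum_ofReal_ne_top

section
variable {Ω : Type*} [MeasurableSpace Ω] {P : Measure Ω} [IsProbabilityMeasure P]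
  {β : ℝ} {m : ℕ → ℕ} {Z : (n j : ℕ) → Fin (n - j) → Ω → ℂ}
  {γ : (n j : ℕ) → Fin (n - j) → Ω → ℝ} {B : ℝ}

/-- Each moment has mean `O(n ^ (B + 1))` and there are at most `n` steps. The weight `n ^ (-(B +
4))` leaves the summable bound `n ^ (-2)`. -/
theorem exists_lintegral_sum_cauchyMoment_le (hβ : 0 < β)
    (hm : ∀ n, 2 ≤ n → m n ≤ n - 1)
    (hmodel : ∀ n, 2 ≤ n → IsIteratedRandomizedDerivative P β n (m n) (Z n) (γ n)) (hB : 0 ≤ B)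
    (hmin : (⨆ (n : ℕ) (_ : 2 ≤ n), ENNReal.ofReal ((n : ℝ) ^ (-B)) *
      ⨆ (j : ℕ) (_ : j < m n), ∫⁻ ω, ⨅ k, ‖Z n j k ω‖ₑ ∂P) < ⊤) (ρ : ℝ) :
    ∃ C : ℝ≥0∞, C < ⊤ ∧ ∀ n, 2 ≤ n → ∫⁻ ω, ∑ j ∈ Finset.range (m n),
      ENNReal.ofReal (Real.exp (-((B + 4) * Real.log n))) *
        cauchyMoment (min (β / 2) 1 / 2) ρ (fun k => γ n j k ω) (fun k => Z n j k ω) ∂P ≤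
      C * ENNReal.ofReal ((n : ℝ) ^ (-2 : ℝ)) := by
  obtain ⟨C, hC, hle⟩ := exists_lintegral_cauchyMoment_le hβ ρ
  set M := ⨆ (n : ℕ) (_ : 2 ≤ n), ENNReal.ofReal ((n : ℝ) ^ (-B)) *
      ⨆ (j : ℕ) (_ : j < m n), ∫⁻ ω, ⨅ k, ‖Z n j k ω‖ₑ ∂P with hM
  refine ⟨C * (2 + M), ENNReal.mul_lt_top hC (ENNReal.add_lt_top.2 ⟨by simp, hmin⟩),
    fun n hn => ?_⟩
  have hmn := hm n hn
  have hn0 : (0 : ℝ) < n := by positivity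
  have hn1 : (1 : ℝ) ≤ n := by exact_mod_cast (by omega : 1 ≤ n)
  have hmin' : ∀ j < m n, ∫⁻ ω, ⨅ k, ‖Z n j k ω‖ₑ ∂P ≤ M * ENNReal.ofReal ((n : ℝ) ^ B) := by
    intro j hj
    have h1 : ENNReal.ofReal ((n : ℝ) ^ (-B)) * ∫⁻ ω, ⨅ k, ‖Z n j k ω‖ₑ ∂P ≤ M := by
      refine le_trans ?_ (le_iSup₂ (f := fun (n : ℕ) (_ : 2 ≤ n) => ENNReal.ofReal ((n : ℝ) ^ (-B)) *
        ⨆ (j : ℕ) (_ : j < m n), ∫⁻ ω, ⨅ k, ‖Z n j k ω‖ₑ ∂P) n hn)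
      gcongr
      exact le_iSup₂ (f := fun (j : ℕ) (_ : j < m n) => ∫⁻ ω, ⨅ k, ‖Z n j k ω‖ₑ ∂P) j hj
    calc _ = ENNReal.ofReal ((n : ℝ) ^ B) * ENNReal.ofReal ((n : ℝ) ^ (-B)) *
          ∫⁻ ω, ⨅ k, ‖Z n j k ω‖ₑ ∂P := by
          rw [← ENNReal.ofReal_mul (by positivity), ← Real.rpow_add hn0]
          simp
      _ ≤ _ := by
          rw [mul_assoc, mul_comm M]
          gcongr
  have hterm : ∀ j < m n, ∫⁻ ω, cauchyMoment (min (β / 2) 1 / 2) ρ (fun k => γ n j k ω)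
      (fun k => Z n j k ω) ∂P ≤ C * (2 + M) * ENNReal.ofReal ((n : ℝ) ^ (B + 1)) := by
    intro j hj
    refine (hle P (hmodel n hn) j hj (by omega)).trans ?_
    rw [mul_assoc]
    gcongr
    have h1 : (n : ℝ≥0∞) ≤ ENNReal.ofReal ((n : ℝ) ^ (B + 1)) := by
      rw [← ENNReal.ofReal_natCast]
      exact ENNReal.ofReal_le_ofReal (Real.self_le_rpow_of_one_le hn1 (by linarith))
    have h2 : (1 : ℝ≥0∞) ≤ ENNReal.ofReal ((n : ℝ) ^ (B + 1)) := by
      rw [ENNReal.one_le_ofReal]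
      exact Real.one_le_rpow hn1 (by linarith)
    have h3 : ENNReal.ofReal ((n : ℝ) ^ B) ≤ ENNReal.ofReal ((n : ℝ) ^ (B + 1)) :=
      ENNReal.ofReal_le_ofReal (Real.rpow_le_rpow_of_exponent_le hn1 (by linarith))
    calc _ ≤ ENNReal.ofReal ((n : ℝ) ^ (B + 1)) + ENNReal.ofReal ((n : ℝ) ^ (B + 1)) +
          M * ENNReal.ofReal ((n : ℝ) ^ (B + 1)) := by
          gcongr
          exact (hmin' j hj).trans (by gcongr)
      _ = _ := by ring
  have hmeas : ∀ j ∈ Finset.range (m n), Measurable fun ω => cauchyMoment (min (β / 2) 1 / 2) ρ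
      (fun k => γ n j k ω) (fun k => Z n j k ω) := by
    exact fun j hj => (hmodel n hn).measurable_cauchyMoment (Finset.mem_range.1 hj) _ ρ
  rw [lintegral_finsetSum' _ fun j hj => ((hmeas j hj).const_mul _).aemeasurable]
  have hexp : Real.exp (-((B + 4) * Real.log n)) = (n : ℝ) ^ (-(B + 4)) := by
    rw [Real.rpow_def_of_pos hn0]
    ring_nf
  calc _ ≤ ∑ j ∈ Finset.range (m n), ENNReal.ofReal ((n : ℝ) ^ (-(B + 4))) *
        (C * (2 + M) * ENNReal.ofReal ((n : ℝ) ^ (B + 1))) := by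
        refine Finset.sum_le_sum fun j hj => ?_
        rw [lintegral_const_mul' _ _ ENNReal.ofReal_ne_top, hexp]
        gcongr
        exact hterm j (Finset.mem_range.1 hj)
    _ ≤ ENNReal.ofReal n * (ENNReal.ofReal ((n : ℝ) ^ (-(B + 4))) *
        (C * (2 + M) * ENNReal.ofReal ((n : ℝ) ^ (B + 1)))) := by
        rw [Finset.sum_const, Finset.card_range, nsmul_eq_mul, ENNReal.ofReal_natCast]
        gcongr
        omega
    _ = C * (2 + M) * (ENNReal.ofReal n * ENNReal.ofReal ((n : ℝ) ^ (-(B + 4))) *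
        ENNReal.ofReal ((n : ℝ) ^ (B + 1))) := by ring
    _ = _ := by
        rw [← ENNReal.ofReal_mul hn0.le, ← ENNReal.ofReal_mul (by positivity)]
        congr 2
        nth_rewrite 1 [← Real.rpow_one (n : ℝ)]
        rw [← Real.rpow_add hn0, ← Real.rpow_add hn0]
        congr 1
        ring

theorem ae_tendsto_totalLogVariation_div (hβ : 0 < β)
    (hm : ∀ n, 2 ≤ n → m n ≤ n - 1)
    (hmodel : ∀ n, 2 ≤ n → IsIteratedRandomizedDerivative P β n (m n) (Z n) (γ n))
    (hrate : Tendsto (fun n : ℕ => (m n : ℝ) / ((n : ℝ) / Real.log n)) atTop (𝓝 0))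
    (hB : 0 ≤ B)
    (hmin : (⨆ (n : ℕ) (_ : 2 ≤ n), ENNReal.ofReal ((n : ℝ) ^ (-B)) *
      ⨆ (j : ℕ) (_ : j < m n), ∫⁻ ω, ⨅ k, ‖Z n j k ω‖ₑ ∂P) < ⊤) (ρ : ℝ) :
    ∀ᵐ ω ∂P, Tendsto (fun n : ℕ => totalLogVariation (m n) ρ (fun j k => Z n j k ω)
      (fun j k => γ n j k ω) / n) atTop (𝓝 0) := by
  obtain ⟨C, hC, hle⟩ := exists_lintegral_sum_cauchyMoment_le hβ hm hmodel hB hmin ρ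
  have hδ : 0 < min (β / 2) 1 / 2 := by positivity
  set δ := min (β / 2) 1 / 2
  set W : ℕ → Ω → ℝ≥0∞ := fun n ω => ∑ j ∈ Finset.range (m n),
      ENNReal.ofReal (Real.exp (-((B + 4) * Real.log n))) *
        cauchyMoment δ ρ (fun k => γ n j k ω) (fun k => Z n j k ω) with hW
  have hWm : ∀ n, 2 ≤ n → Measurable (W n) := by
    intro n hn
    exact Finset.measurable_fun_sum _ fun j hj =>
      ((hmodel n hn).measurable_cauchyMoment (Finset.mem_range.1 hj) _ ρ).const_mul _
  -- The shift by `2` is there because the model is only assumed for `n ≥ 2`.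
  have hsum : ∑' n, ∫⁻ ω, W (n + 2) ω ∂P ≠ ⊤ := by
    refine ne_top_of_le_ne_top ?_ (ENNReal.tsum_le_tsum fun n => hle (n + 2) (by omega))
    rw [ENNReal.tsum_mul_left]
    exact ENNReal.mul_ne_top hC.ne tsum_ofReal_rpow_neg_two_ne_top
  filter_upwards [ae_forall_le_of_tsum_lintegral_ne_top
    (fun n => (hWm (n + 2) (by omega)).aemeasurable) hsum] with ω ⟨T, hT, hWT⟩
  set V := volume (Metric.closedBall (0 : ℂ) ρ) with hV
  have hV' : V ≠ ⊤ := measure_closedBall_lt_top.ne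
  -- The first term is the rate hypothesis times a constant; the second is the bounded random
  -- remainder divided by `n`.
  have hlim : Tendsto (fun n : ℕ => ENNReal.ofReal ((m n : ℝ) / ((n : ℝ) / Real.log n) *
      ((B + 4) * (1 + δ⁻¹))) * V + T * (n : ℝ≥0∞)⁻¹) atTop (𝓝 0) := by
    have h1 := ENNReal.Tendsto.mul_const (b := V) (ENNReal.tendsto_ofReal
      (hrate.mul_const ((B + 4) * (1 + δ⁻¹)))) (Or.inr hV')
    have h2 := ENNReal.Tendsto.const_mul (a := T) ENNReal.tendsto_inv_nat_nhds_zero (Or.inr hT.ne)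
    simpa using h1.add h2
  refine tendsto_of_tendsto_of_tendsto_of_le_of_le' tendsto_const_nhds hlim
    (Eventually.of_forall fun _ => zero_le) ?_
  filter_upwards [eventually_ge_atTop 2] with n hn
  have hn0 : (0 : ℝ) < n := by positivity
  have hlog : 0 < Real.log n := Real.log_pos (by exact_mod_cast (by omega : 1 < n))
  have hL : 0 ≤ (B + 4) * Real.log n := by positivity
  have hWn : W n ω ≤ T := by
    obtain ⟨l, rfl⟩ := Nat.exists_eq_add_of_le' hn
    exact hWT l
  calc totalLogVariation (m n) ρ (fun j k => Z n j k ω) (fun j k => γ n j k ω) / n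
      ≤ (∑ j ∈ Finset.range (m n), (ENNReal.ofReal ((B + 4) * Real.log n * (1 + δ⁻¹)) * V +
        ENNReal.ofReal (Real.exp (-((B + 4) * Real.log n))) *
          cauchyMoment δ ρ (fun k => γ n j k ω) (fun k => Z n j k ω))) / n := by
        refine ENNReal.div_le_div_right (Finset.sum_le_sum fun j _ => ?_) _
        exact lintegral_enorm_log_weightedCauchySum_le hL hδ ρ _ _
    _ = (m n * (ENNReal.ofReal ((B + 4) * Real.log n * (1 + δ⁻¹)) * V) + W n ω) *
        (n : ℝ≥0∞)⁻¹ := by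
        rw [Finset.sum_add_distrib, Finset.sum_const, Finset.card_range, nsmul_eq_mul,
          div_eq_mul_inv]
    _ ≤ (m n * (ENNReal.ofReal ((B + 4) * Real.log n * (1 + δ⁻¹)) * V) + T) *
        (n : ℝ≥0∞)⁻¹ := by gcongr
    _ = _ := by
        rw [add_mul]
        congr 1
        rw [← ENNReal.ofReal_natCast (m n), ← ENNReal.ofReal_natCast n,
          ← ENNReal.ofReal_inv_of_pos hn0, ← mul_assoc, ← ENNReal.ofReal_mul (by positivity),
          mul_right_comm, ← ENNReal.ofReal_mul (by positivity)]
        congr 2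
        field_simp

end

theorem tendsto_div_of_tendsto_div_div_log {u : ℕ → ℝ}
    (h : Tendsto (fun n : ℕ => u n / ((n : ℝ) / Real.log n)) atTop (𝓝 0)) :
    Tendsto (fun n : ℕ => u n / n) atTop (𝓝 0) := by
  have hlog : Tendsto (fun n : ℕ => (Real.log n)⁻¹) atTop (𝓝 0) :=
    (Real.tendsto_log_atTop.comp tendsto_natCast_atTop_atTop).inv_tendsto_atTop
  have h1 := h.mul hlog
  rw [mul_zero] at h1
  refine h1.congr' ?_
  filter_upwards [eventually_ge_atTop 2] with n hn
  have hn0 : (0 : ℝ) < n := by positivity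
  have hlog : 0 < Real.log n := Real.log_pos (by exact_mod_cast (by omega : 1 < n))
  field_simp

theorem theorem2 {Ω : Type*} [MeasurableSpace Ω] (P : Measure Ω) [IsProbabilityMeasure P]
    (β : ℝ) (hβ : 0 < β)
    (m : ℕ → ℕ) (hm : ∀ n, 2 ≤ n → 1 ≤ m n ∧ m n ≤ n - 1)
    (Z : (n j : ℕ) → Fin (n - j) → Ω → ℂ)
    (γ : (n j : ℕ) → Fin (n - j) → Ω → ℝ)
    (hmodel : ∀ n, 2 ≤ n → IsIteratedRandomizedDerivative P β n (m n) (Z n) (γ n))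
    (μ : FiniteMeasure ℂ)
    (hconv : ∀ᵐ ω ∂P,
      Tendsto (fun n => empiricalMeasure (fun k => Z n 0 k ω)) atTop (𝓝 μ))
    (hrate : Tendsto (fun n : ℕ => (m n : ℝ) / ((n : ℝ) / Real.log n)) atTop (𝓝 0))
    (B : ℝ) (hB : 0 ≤ B)
    (hmin : (⨆ (n : ℕ) (_ : 2 ≤ n), ENNReal.ofReal ((n : ℝ) ^ (-B)) *
      ⨆ (j : ℕ) (_ : j < m n), ∫⁻ ω, ⨅ k, ‖Z n j k ω‖ₑ ∂P) < ⊤) :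
    ∀ᵐ ω ∂P,
      Tendsto (fun n => empiricalMeasure (fun k => Z n (m n) k ω)) atTop (𝓝 μ) := by
  have hvar := ae_all_iff.2 fun ρ : ℕ =>
    ae_tendsto_totalLogVariation_div hβ (fun n hn => (hm n hn).2) hmodel hrate hB hmin ρ
  have hroots : ∀ᵐ ω ∂P, ∀ n, 2 ≤ n → ∀ j < m n, Finset.univ.val.map (fun k => Z n (j + 1) k ω) =
      (randomizedDerivative (fun k => γ n j k ω) (fun k => Z n j k ω)).roots := by
    simp only [ae_all_iff]
    exact fun n hn j hj => (hmodel n hn).roots_step j hj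
  filter_upwards [hconv, hvar, hroots] with ω h1 h2 h3
  exact tendsto_empiricalMeasure_of_totalLogVariation (z := fun n j k => Z n j k ω)
    (w := fun n j k => γ n j k ω) (fun n hn => (hm n hn).2)
    (tendsto_div_of_tendsto_div_div_log hrate) h3 h1 h2
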